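/- Let $S\subset\mathbb{R}^n$ be a smooth compact hypersurface (without boundary), and let $\vec n$ be a continuous unit normal field on $S$ (for instance the outward unit normal, when $S$ is regarded as the boundary of a bounded domain). For $h>0$ let $g_1^h,g_2^h:S\to(0,\infty)$ be smooth and put $$S^h=\{x+t\,\vec n(x):\ x\in S,\ -g_1^h(x)<t<g_2^h(x)\}.$$ Assume (H1): there are positive constants $C_1,C_2,C_3$ and $h_0>0$ such that, for all $0<h<h_0$, $$C_1h\le g_i^h(x)\le C_2h,\qquad |\nabla g_i^h(x)|\le C_3h\qquad\text{for all }x\in S,\ i=1,2,$$ where $\nabla g_i^h$ is the tangential gradient on $S$. Then there are constants $C>0$ and $h_1>0$, depending only on $S$, $\vec n$ and $C_1,C_2,C_3$, such that for every $0<h<\min(h_0,h_1)$, every $u\in W^{1,2}(S^h)$ has traces in $L^2$ on $S$ and on the boundary $\partial S^h$, and these satisfy $$\|u\|_{L^2(S)}\le C h^{-1/2}\|u\|_{L^2(S^h)}+C h^{1/2}\|\nabla u\|_{L^2(S^h)},$$ $$\|u\|_{L^2(\partial S^h)}\le C h^{-1/2}\|u\|_{L^2(S^h)}+C h^{1/2}\|\nabla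 u\|_{L^2(S^h)}.$$ Here $L^2(S)$ and $L^2(\partial S^h)$ are taken with respect to the $(n-1)$-dimensional surface measure, and the constant $C$ is independent of $u$ and of $h$. A function $w\in L^2(T)$, with $T=S$ or $T=\partial S^h$, is the trace of $u$ on $T$ if there are functions $v_k\in C^\infty(\mathbb{R}^n)$ with $v_k\to u$ in $W^{1,2}(S^h)$ and $v_k|_T\to w$ in $L^2(T)$. -/

import Mathlib

open MeasureTheory Filter Topology
open scoped ContDiff Gradient

/-- Euclidean space `ℝⁿ`. -/
abbrev Eucl (n : ℕ) := EuclideanSpace ℝ (Fin n)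

/-- `φ` is a smooth local defining function of `S` at `x`: near `x` the set `S` is the zero level
set of `φ`, and `∇φ(x) ≠ 0`. (A function that is only defined and smooth near `x` can be cut off
without changing it near `x`, so taking `φ` smooth on all of `ℝⁿ` is no restriction.) -/
def IsLocalDefiningFunction {n : ℕ} (S : Set (Eucl n)) (φ : Eucl n → ℝ) (x : Eucl n) : Prop :=
  ContDiff ℝ ∞ φ ∧ ∇ φ x ≠ 0 ∧ ∀ᶠ y in 𝓝 x, (y ∈ S ↔ φ y = 0)

/-- `S` is a smooth (embedded, boundaryless, codimension one) hypersurface of `ℝⁿ`. -/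
def IsSmoothHypersurface {n : ℕ} (S : Set (Eucl n)) : Prop :=
  ∀ x ∈ S, ∃ φ, IsLocalDefiningFunction S φ x

/-- `ν` is a continuous (hence smooth) unit normal field on `S`: near each point of `S` it is the
normalized gradient of a local defining function. The outward normal of a smooth domain
`{φ < 0}` with boundary `S` is of this form. Values of `ν` off `S` are irrelevant. -/
def IsUnitNormalField {n : ℕ} (S : Set (Eucl n)) (ν : Eucl n → Eucl n) : Prop :=
  ∀ x ∈ S, ∃ φ, IsLocalDefiningFunction S φ x ∧
    ∀ᶠ y in 𝓝[S] x, ν y = ‖∇ φ y‖⁻¹ • ∇ φ y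

/-- `g`, as a function on `S`, is smooth: locally it is the restriction of a smooth function. -/
def IsSmoothOnSurface {n : ℕ} (S : Set (Eucl n)) (g : Eucl n → ℝ) : Prop :=
  ∀ x ∈ S, ∃ G : Eucl n → ℝ, ContDiff ℝ ∞ G ∧ G =ᶠ[𝓝[S] x] g

/-- `w` is the (tangential) gradient at `x` of `g : S → ℝ`: the projection onto
`T_x S = ν(x)^⊥` of the gradient of a local smooth extension of `g`. -/
def HasSurfaceGradientAt {n : ℕ} (S : Set (Eucl n)) (ν : Eucl n → Eucl n) (g : Eucl n → ℝ)
    (x w : Eucl n) : Prop :=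
  ∃ G : Eucl n → ℝ, ContDiff ℝ ∞ G ∧ G =ᶠ[𝓝[S] x] g ∧
    w = ∇ G x - (inner ℝ (∇ G x) (ν x)) • ν x

/-- The thin shell `{x + t ν(x) ; x ∈ S, -g₁(x) < t < g₂(x)}`. -/
def thinShell {n : ℕ} (S : Set (Eucl n)) (ν : Eucl n → Eucl n) (g₁ g₂ : Eucl n → ℝ) :
    Set (Eucl n) :=
  {z | ∃ x ∈ S, ∃ t : ℝ, -g₁ x < t ∧ t < g₂ x ∧ z = x + t • ν x}

/-- The bounds `C₁ h ≤ g ≤ C₂ h` and `|∇g| ≤ C₃ h` on `S`. -/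
def ThicknessBounds {n : ℕ} (S : Set (Eucl n)) (ν : Eucl n → Eucl n) (C₁ C₂ C₃ h : ℝ)
    (g : Eucl n → ℝ) : Prop :=
  ∀ x ∈ S, C₁ * h ≤ g x ∧ g x ≤ C₂ * h ∧ ∀ w, HasSurfaceGradientAt S ν g x w → ‖w‖ ≤ C₃ * h

/-- Hypothesis (H1) on the families `g₁ = (g₁ʰ)`, `g₂ = (g₂ʰ)` of smooth functions on `S`, valid
for all `0 < h < h₀`. -/
def HypothesisH1 {n : ℕ} (S : Set (Eucl n)) (ν : Eucl n → Eucl n) (C₁ C₂ C₃ h₀ : ℝ)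
    (g₁ g₂ : ℝ → Eucl n → ℝ) : Prop :=
  ∀ h, 0 < h → h < h₀ →
    (IsSmoothOnSurface S (g₁ h) ∧ ThicknessBounds S ν C₁ C₂ C₃ h (g₁ h)) ∧
    (IsSmoothOnSurface S (g₂ h) ∧ ThicknessBounds S ν C₁ C₂ C₃ h (g₂ h))

/-- `u ∈ W^{1,2}(Ω)` with weak gradient `G`. -/
structure IsSobolevW12 {n : ℕ} (Ω : Set (Eucl n)) (u : Eucl n → ℝ) (G : Eucl n → Eucl n) :
    Prop where
  memLp : MemLp u 2 (volume.restrict Ω)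
  memLp_grad : MemLp G 2 (volume.restrict Ω)
  weak_grad : ∀ (φ : Eucl n → ℝ), ContDiff ℝ ∞ φ → HasCompactSupport φ → tsupport φ ⊆ Ω →
    ∀ v : Eucl n,
      ∫ z in Ω, u z * inner ℝ (∇ φ z) v = - ∫ z in Ω, inner ℝ (G z) v * φ z

/-- The surface measure (normalized `(n-1)`-dimensional Hausdorff measure) on `T ⊆ ℝⁿ`. -/
noncomputable def surfaceMeasure {n : ℕ} (T : Set (Eucl n)) : Measure (Eucl n) :=
  (μHE[n - 1] : Measure (Eucl n)).restrict T

/-- `w ∈ L²(T)` is the trace on the hypersurface `T ⊆ closure Ω` of `u ∈ W^{1,2}(Ω)` with weak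
gradient `G`: some sequence of functions that are smooth up to the boundary converges to `u` in
`W^{1,2}(Ω)`, and its restrictions to `T` converge to `w` in `L²(T)`. -/
def IsSobolevTrace {n : ℕ} (Ω T : Set (Eucl n)) (u : Eucl n → ℝ) (G : Eucl n → Eucl n)
    (w : Eucl n → ℝ) : Prop :=
  MemLp w 2 (surfaceMeasure T) ∧
  ∃ v : ℕ → Eucl n → ℝ, (∀ k, ContDiff ℝ ∞ (v k)) ∧
    Tendsto (fun k => eLpNorm (v k - u) 2 (volume.restrict Ω)) atTop (𝓝 0) ∧
    Tendsto (fun k => eLpNorm (∇ (v k) - G) 2 (volume.restrict Ω)) atTop (𝓝 0) ∧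
    Tendsto (fun k => eLpNorm (v k - w) 2 (surfaceMeasure T)) atTop (𝓝 0)

/-!
The trace inequality is first proved for smooth functions, and then extended to `W^{1,2}` by
density.

*Smooth functions.* On a segment of length `ℓ` one has `φ(s)² ≤ 2/ℓ ∫ φ² + ℓ ∫ φ'²`
(`sq_le_integral_of_hasDerivAt`). This is applied to each normal segment `{x + t ν(x) : -g₁(x) < t
< g₂(x)}`, whose length is comparable to `h`, and integrated over `S`. The iterated integral over
`S` and the normal lines is bounded by a volume integral (`HasTube.exists_tube_bound`), because
`S` is locally a Lipschitz graph over a compact piece of the tangent plane and the normal map `(x,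
t) ↦ x + t ν(x)` is bi-Lipschitz there. Both `S` and the two boundary components of the shell are
graphs `{x + s(x) ν(x)}` with a height `s` of small slope; the graph map is locally `2`-Lipschitz,
so the surface measure on the graph is bounded by that of `S` (`setLIntegral_image_le`). All
constants depend on `S`, `ν`, `C₁`, `C₂`, `C₃` only, which uses the uniform tube of
`IsUnitNormalField.exists_hasTube`.

*Density.* For `h` small, the inverse function theorem gives normal coordinates `(π, d)` in the
tube (`HasNormalCoordinatesAt`). They show that the shell is open, that its frontier lies on the
two graphs, and that near a boundary point it is a sublevel set of a strictly differentiable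
function with nonzero derivative. The shell therefore satisfies an interior cone condition
(`HasTube.hasInteriorConeAt`), so that mollifiers with shifted support, glued by a partition of
unity, approximate `W^{1,2}` functions by smooth functions on `ℝⁿ`
(`IsSobolevW12.exists_contDiff_approx`). By the inequality for smooth functions the approximations
are Cauchy in `L²` of the surface; the limit is a trace, and the inequality passes to every trace
(`IsSobolevW12.exists_isSobolevTrace`, `IsSobolevTrace.eLpNorm_le`).
-/

/-! ### Mollification in `L²` -/

section Mollification

variable {E F : Type*} [NormedAddCommGroup E] [NormedSpace ℝ E] [FiniteDimensional ℝ E]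
  [MeasurableSpace E] [BorelSpace E] [NormedAddCommGroup F]
  {μ : Measure E} [μ.IsAddHaarMeasure]

/-- Translations act continuously on `L²`. -/
theorem tendsto_eLpNorm_translate_sub {f : E → F} (hf : MemLp f 2 μ) :
    Tendsto (fun y => eLpNorm (fun p => f (p - y) - f p) 2 μ) (𝓝 0) (𝓝 0) := by
  let g : E → C(E, E) := (ContinuousMap.mk (fun a : E × E => a.2 - a.1) (by fun_prop)).curry
  have hg : Continuous g := ContinuousMap.continuous _
  have hgm : ∀ y, MeasurePreserving (g y) μ μ := fun y => measurePreserving_sub_right μ y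
  have : Fact ((1 : ENNReal) ≤ 2) := ⟨by norm_num⟩
  have hc : Continuous fun y => Lp.compMeasurePreserving (g y) (hgm y) hf.toLp :=
    Continuous.compMeasurePreservingLp continuous_const hg hgm (by norm_num)
  have ht := (Lp.tendsto_Lp_iff_tendsto_eLpNorm' _ _).1 (hc.tendsto 0)
  refine ht.congr fun y => eLpNorm_congr_ae ?_
  have h1 : ∀ y, (Lp.compMeasurePreserving (g y) (hgm y) hf.toLp : E → F)
      =ᵐ[μ] fun p => f (p - y) := fun y =>
    (Lp.coeFn_compMeasurePreserving _ (hgm y)).trans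
      ((hgm y).quasiMeasurePreserving.ae_eq_comp hf.coeFn_toLp)
  filter_upwards [h1 y, h1 0] with p hp hp0
  rw [Pi.sub_apply, hp, hp0, sub_zero]

/-- The square of a weighted average is at most the weighted average of the squares. -/
theorem sq_lintegral_mul_le {α : Type*} [MeasurableSpace α] {ν : Measure α} {w g : α → ENNReal}
    (hw : AEMeasurable w ν) (hg : AEMeasurable g ν) (hw1 : ∫⁻ t, w t ∂ν = 1) :
    (∫⁻ t, w t * g t ∂ν) ^ 2 ≤ ∫⁻ t, w t * g t ^ 2 ∂ν := by
  have key := ENNReal.lintegral_mul_le_Lp_mul_Lq ν Real.HolderConjugate.two_two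
    (f := fun t => w t ^ (1 / 2 : ℝ)) (g := fun t => w t ^ (1 / 2 : ℝ) * g t)
    (hw.pow_const _) ((hw.pow_const _).mul hg)
  have e1 : ∀ t, ((fun t => w t ^ (1 / 2 : ℝ)) * fun t => w t ^ (1 / 2 : ℝ) * g t) t
      = w t * g t := by
    intro t
    simp only [Pi.mul_apply, ← mul_assoc, ← ENNReal.rpow_add_of_nonneg (1 / 2 : ℝ) (1 / 2)
      (by norm_num) (by norm_num)]
    norm_num
  have e2 : ∀ t, (w t ^ (1 / 2 : ℝ)) ^ (2 : ℝ) = w t := by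
    intro t; rw [← ENNReal.rpow_mul]; norm_num
  simp only [e1, e2, hw1, ENNReal.mul_rpow_of_nonneg _ _ (zero_le_two : (0 : ℝ) ≤ 2),
    ENNReal.one_rpow, one_mul] at key
  calc (∫⁻ t, w t * g t ∂ν) ^ 2 ≤ ((∫⁻ t, w t * g t ^ (2 : ℝ) ∂ν) ^ (1 / 2 : ℝ)) ^ 2 := by gcongr
    _ = _ := by
      rw [← ENNReal.rpow_natCast, ← ENNReal.rpow_mul]
      norm_num

theorem eLpNorm_two_sq {α G : Type*} [MeasurableSpace α] [NormedAddCommGroup G] (ν : Measure α)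
    (f : α → G) : eLpNorm f 2 ν ^ 2 = ∫⁻ x, ‖f x‖ₑ ^ 2 ∂ν := by
  rw [eLpNorm_eq_lintegral_rpow_enorm_toReal (by norm_num) (by norm_num), ← ENNReal.rpow_natCast,
    ← ENNReal.rpow_mul]
  norm_num

open ContinuousLinearMap in
/-- A mollified function `η ⋆ f` is an average of translates of `f`, so its `L²` distance to `f` is
at most that of the worst translate. No symmetry of `η` is needed. -/
theorem eLpNorm_convolution_sub_le [NormedSpace ℝ F] [CompleteSpace F]
    {f : E → F} (hf : MemLp f 2 μ) {η : E → ℝ}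
    (hη : Continuous η) (hηs : HasCompactSupport η) (hη0 : ∀ x, 0 ≤ η x)
    (hη1 : ∫ x, η x ∂μ = 1) {A : ENNReal}
    (hA : ∀ y ∈ Function.support η, eLpNorm (fun p => f (p - y) - f p) 2 μ ≤ A) :
    eLpNorm (convolution η f (lsmul ℝ ℝ) μ - f) 2 μ ≤ A := by
  have hint : Integrable η μ := hη.integrable_of_hasCompactSupport hηs
  have hw1 : ∫⁻ t, ENNReal.ofReal (η t) ∂μ = 1 := by
    rw [← ofReal_integral_eq_lintegral_ofReal hint (ae_of_all _ hη0), hη1, ENNReal.ofReal_one]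
  have hwm : Measurable fun t => ENNReal.ofReal (η t) := hη.measurable.ennreal_ofReal
  have hloc : LocallyIntegrable f μ := hf.locallyIntegrable (by norm_num)
  have hmeas : AEStronglyMeasurable (fun q : E × E => f (q.1 - q.2) - f q.1) (μ.prod μ) :=
    (hf.1.comp_quasiMeasurePreserving
      (quasiMeasurePreserving_sub_of_right_invariant μ μ)).sub hf.1.comp_fst
  have hpt : ∀ᵐ p ∂μ, ‖(convolution η f (lsmul ℝ ℝ) μ - f) p‖ₑ ^ 2
      ≤ ∫⁻ t, ENNReal.ofReal (η t) * ‖f (p - t) - f p‖ₑ ^ 2 ∂μ := by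
    filter_upwards [hmeas.prodMk_left] with p hp
    have hce : Integrable (fun t => η t • f (p - t)) μ :=
      hηs.convolutionExists_left (lsmul ℝ ℝ) hη hloc p
    have heq : (convolution η f (lsmul ℝ ℝ) μ - f) p = ∫ t, η t • (f (p - t) - f p) ∂μ := by
      simp only [smul_sub, Pi.sub_apply]
      rw [integral_sub hce (hint.smul_const _), integral_smul_const, hη1, one_smul]
      rfl
    rw [heq]
    refine le_trans ?_ (sq_lintegral_mul_le hwm.aemeasurable hp.enorm hw1)
    gcongr
    refine (enorm_integral_le_lintegral_enorm _).trans (le_of_eq (lintegral_congr fun t => ?_))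
    rw [enorm_smul, Real.enorm_eq_ofReal (hη0 t)]
  rw [← ENNReal.pow_le_pow_left_iff two_ne_zero, eLpNorm_two_sq]
  calc _ ≤ ∫⁻ p, ∫⁻ t, ENNReal.ofReal (η t) * ‖f (p - t) - f p‖ₑ ^ 2 ∂μ ∂μ := lintegral_mono_ae hpt
    _ = ∫⁻ t, ∫⁻ p, ENNReal.ofReal (η t) * ‖f (p - t) - f p‖ₑ ^ 2 ∂μ ∂μ := by
      refine lintegral_lintegral_swap ?_
      exact (hwm.comp measurable_snd).aemeasurable.mul (hmeas.enorm.pow_const 2)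
    _ = ∫⁻ t, ENNReal.ofReal (η t) * eLpNorm (fun p => f (p - t) - f p) 2 μ ^ 2 ∂μ := by
      refine lintegral_congr fun t => ?_
      rw [lintegral_const_mul' _ _ ENNReal.ofReal_ne_top, eLpNorm_two_sq]
    _ ≤ ∫⁻ t, ENNReal.ofReal (η t) * A ^ 2 ∂μ := by
      refine lintegral_mono fun t => ?_
      by_cases ht : t ∈ Function.support η
      · dsimp only; gcongr; exact hA t ht
      · simp [Function.notMem_support.1 ht]
    _ = A ^ 2 := by rw [lintegral_mul_const _ hwm, hw1, one_mul]

open ContinuousLinearMap in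
theorem tendsto_eLpNorm_convolution_sub [NormedSpace ℝ F] [CompleteSpace F]
    {f : E → F} (hf : MemLp f 2 μ)
    {η : ℕ → E → ℝ}
    (hη : ∀ k, Continuous (η k)) (hηs : ∀ k, HasCompactSupport (η k)) (hη0 : ∀ k x, 0 ≤ η k x)
    (hη1 : ∀ k, ∫ x, η k x ∂μ = 1)
    (hsupp : Tendsto (fun k => Function.support (η k)) atTop (𝓝 (0 : E)).smallSets) :
    Tendsto (fun k => eLpNorm (convolution (η k) f (lsmul ℝ ℝ) μ - f) 2 μ) atTop (𝓝 0) := by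
  refine ENNReal.tendsto_nhds_zero.2 fun A hA => ?_
  have h := (ENNReal.tendsto_nhds_zero.1 (tendsto_eLpNorm_translate_sub hf) A hA)
  filter_upwards [tendsto_smallSets_iff.1 hsupp _ h] with k hk
  exact eLpNorm_convolution_sub_le hf (hη k) (hηs k) (hη0 k) (hη1 k) fun y hy => hk hy

end Mollification

/-! ### Local smooth approximation under a cone condition -/

section Approximation

variable {n : ℕ} {Ω : Set (Eucl n)} {u : Eucl n → ℝ} {G : Eucl n → Eucl n}

open ContinuousLinearMap in
/-- At a point `p` whose translates `p - t`, `t ∈ supp η`, stay in `Ω`, mollification of the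
extensions by zero commutes with the weak gradient: the jump of the extension across the boundary
of `Ω` is not seen. -/
theorem IsSobolevW12.gradient_convolution (hΩ : MeasurableSet Ω) (hu : IsSobolevW12 Ω u G)
    {η : Eucl n → ℝ} (hη : ContDiff ℝ ∞ η) (hηs : HasCompactSupport η) {p : Eucl n}
    (hp : ∀ t ∈ tsupport η, p - t ∈ Ω) :
    ∇ (convolution η (Ω.indicator u) (lsmul ℝ ℝ) volume) p
      = convolution η (Ω.indicator G) (lsmul ℝ ℝ) volume p := by
  have hul : LocallyIntegrable (Ω.indicator u) volume :=
    ((memLp_indicator_iff_restrict hΩ).2 hu.memLp).locallyIntegrable (by norm_num)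
  have hGl : LocallyIntegrable (Ω.indicator G) volume :=
    ((memLp_indicator_iff_restrict hΩ).2 hu.memLp_grad).locallyIntegrable (by norm_num)
  have hη1 : ContDiff ℝ 1 η := hη.of_le (by exact_mod_cast le_top)
  have hd := hηs.hasFDerivAt_convolution_left (lsmul ℝ ℝ) hη1 hul p
  have hGi : Integrable (fun t => (lsmul ℝ ℝ : ℝ →L[ℝ] Eucl n →L[ℝ] Eucl n) (η t)
      (Ω.indicator G (p - t))) volume :=
    hηs.convolutionExists_left (lsmul ℝ ℝ) hη.continuous hGl p
  have hui := (hηs.fderiv ℝ).convolutionExists_left ((lsmul ℝ ℝ : ℝ →L[ℝ] ℝ →L[ℝ] ℝ).precompL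
    (Eucl n)) (hη1.continuous_fderiv one_ne_zero) hul p
  -- the weak gradient is tested against the reflected and translated mollifier
  have hφ : ContDiff ℝ ∞ fun q => η (p - q) := by fun_prop
  have htsup : tsupport (fun q => η (p - q)) = (fun q => p - q) ⁻¹' tsupport η :=
    (tsupport_comp_eq_preimage η (Homeomorph.subLeft p))
  have hφs : HasCompactSupport fun q => η (p - q) :=
    hηs.comp_homeomorph (Homeomorph.subLeft p)
  have hφΩ : tsupport (fun q => η (p - q)) ⊆ Ω := by
    rw [htsup]
    intro q hq
    simpa using hp (p - q) hq
  refine ext_inner_right ℝ fun v => ?_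
  have hgrad : ∀ q, inner ℝ (∇ (fun q => η (p - q)) q) v = - fderiv ℝ η (p - q) v := by
    intro q
    rw [inner_gradient_left]
    have h1 : HasFDerivAt (fun q => η (p - q)) (-(fderiv ℝ η (p - q))) q := by
      have := ((hη1.differentiable one_ne_zero) (p - q)).hasFDerivAt.comp q
        ((hasFDerivAt_id q).const_sub p)
      simpa [Function.comp_def] using this
    rw [h1.fderiv]; simp
  have key := hu.weak_grad _ hφ hφs hφΩ v
  rw [inner_gradient_left, hd.fderiv, convolution_def, ContinuousLinearMap.integral_apply hui]
  rw [convolution_def]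
  rw [real_inner_comm, ← integral_inner hGi]
  have e1 : ∫ t, (((lsmul ℝ ℝ : ℝ →L[ℝ] ℝ →L[ℝ] ℝ).precompL (Eucl n)) (fderiv ℝ η t)
      (Ω.indicator u (p - t))) v = - ∫ z in Ω, u z * inner ℝ (∇ (fun q => η (p - q)) z) v := by
    rw [← integral_sub_left_eq_self _ volume p, ← integral_neg, ← integral_indicator hΩ]
    refine integral_congr_ae (ae_of_all _ fun q => ?_)
    by_cases hq : q ∈ Ω
    · simp [hq, hgrad, mul_comm]
    · simp [hq]
  have e2 : ∫ t, inner ℝ v (((lsmul ℝ ℝ : ℝ →L[ℝ] Eucl n →L[ℝ] Eucl n)) (η t)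
      (Ω.indicator G (p - t))) = ∫ z in Ω, inner ℝ (G z) v * η (p - z) := by
    rw [← integral_sub_left_eq_self _ volume p, ← integral_indicator hΩ]
    refine integral_congr_ae (ae_of_all _ fun q => ?_)
    by_cases hq : q ∈ Ω
    · simp [hq, inner_smul_right, real_inner_comm, mul_comm]
    · simp [hq]
  rw [e1, key, neg_neg]
  exact e2.symm

/-- The interior cone condition at `z`, uniform in the points of `Ω` near `z`: along one direction
`-e`, every point of `Ω` close to `z` can be pushed into `Ω` by a distance comparable to its
displacement. Interior points satisfy it with `e = 0`. -/
def HasInteriorConeAt (Ω : Set (Eucl n)) (z : Eucl n) : Prop :=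
  ∃ (e : Eucl n) (c ρ : ℝ), 0 < c ∧ 0 < ρ ∧ ∀ p ∈ Ω, dist p z < ρ → ∀ ε, 0 < ε → ε < ρ →
    Metric.ball (p - ε • e) (c * ε) ⊆ Ω

open ContinuousLinearMap in
/-- Smooth approximation near a point satisfying the cone condition. The functions `W k` converge
to `u` on all of `Ω`, but their gradients agree with the convergent sequence `H k` only near `z`. -/
theorem IsSobolevW12.exists_local_approx (hΩ : MeasurableSet Ω) (hu : IsSobolevW12 Ω u G)
    {z : Eucl n} (hz : HasInteriorConeAt Ω z) :
    ∃ ρ > 0, ∃ (W : ℕ → Eucl n → ℝ) (H : ℕ → Eucl n → Eucl n),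
      (∀ k, ContDiff ℝ ∞ (W k)) ∧ (∀ k, Continuous (H k)) ∧
      (∀ k, ∀ p ∈ Ω, dist p z < ρ → ∇ (W k) p = H k p) ∧
      Tendsto (fun k => eLpNorm (W k - u) 2 (volume.restrict Ω)) atTop (𝓝 0) ∧
      Tendsto (fun k => eLpNorm (H k - G) 2 (volume.restrict Ω)) atTop (𝓝 0) := by
  obtain ⟨e, c, ρ, hc, hρ, hcone⟩ := hz
  set ε : ℕ → ℝ := fun k => ρ / (k + 2) with hε
  have hε0 : ∀ k, 0 < ε k := fun k => by positivity
  have hερ : ∀ k, ε k < ρ := fun k => by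
    rw [hε, div_lt_iff₀ (by positivity)]
    nlinarith [(Nat.cast_nonneg k : (0 : ℝ) ≤ k)]
  have hεt : Tendsto ε atTop (𝓝 0) :=
    tendsto_const_nhds.div_atTop (tendsto_atTop_add_const_right _ _ tendsto_natCast_atTop_atTop)
  -- mollifiers centred at `ε e`, so that the averages are taken over balls inside the cone
  let b : (k : ℕ) → ContDiffBump (ε k • e) := fun k =>
    ⟨c * ε k / 4, c * ε k / 2, by have := hε0 k; positivity,
      by have := mul_pos hc (hε0 k); linarith⟩
  set η : ℕ → Eucl n → ℝ := fun k => (b k).normed volume with hηdef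
  have hη : ∀ k, ContDiff ℝ ∞ (η k) := fun k => (b k).contDiff_normed
  have hηs : ∀ k, HasCompactSupport (η k) := fun k => (b k).hasCompactSupport_normed
  have hsupp : Tendsto (fun k => Function.support (η k)) atTop (𝓝 (0 : Eucl n)).smallSets := by
    rw [Metric.nhds_basis_ball.smallSets.tendsto_right_iff]
    intro δ hδ
    have ht : Tendsto (fun k => ε k * ‖e‖ + c * ε k / 2) atTop (𝓝 0) := by
      simpa using (hεt.mul_const ‖e‖).add ((hεt.const_mul c).div_const 2)
    filter_upwards [ht.eventually (gt_mem_nhds hδ)] with k hk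
    rw [Set.mem_powerset_iff, hηdef, (b k).support_normed_eq]
    intro y hy
    rw [mem_ball_zero_iff]
    have h1 : ‖y - ε k • e‖ < c * ε k / 2 := by simpa [dist_eq_norm] using hy
    calc ‖y‖ = ‖(ε k • e) + (y - ε k • e)‖ := by congr 1; abel
      _ ≤ ‖ε k • e‖ + ‖y - ε k • e‖ := norm_add_le _ _
      _ < ε k * ‖e‖ + c * ε k / 2 := by
        rw [norm_smul, Real.norm_of_nonneg (hε0 k).le]; linarith
      _ < δ := hk
  have hul : MemLp (Ω.indicator u) 2 volume := (memLp_indicator_iff_restrict hΩ).2 hu.memLp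
  have hGl : MemLp (Ω.indicator G) 2 volume := (memLp_indicator_iff_restrict hΩ).2 hu.memLp_grad
  have conv : ∀ {F : Type} [NormedAddCommGroup F] [NormedSpace ℝ F] [CompleteSpace F]
      (f : Eucl n → F), MemLp (Ω.indicator f) 2 volume →
      Tendsto (fun k => eLpNorm (convolution (η k) (Ω.indicator f) (lsmul ℝ ℝ) volume - f) 2
        (volume.restrict Ω)) atTop (𝓝 0) := by
    intro F _ _ _ f hf
    refine tendsto_of_tendsto_of_tendsto_of_le_of_le tendsto_const_nhds
      (tendsto_eLpNorm_convolution_sub hf (fun k => (hη k).continuous) hηs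
        (fun k => (b k).nonneg_normed) (fun k => (b k).integral_normed) hsupp)
      (fun _ => zero_le) fun k => ?_
    refine le_trans (le_of_eq (eLpNorm_congr_ae ?_))
      (eLpNorm_mono_measure _ Measure.restrict_le_self)
    filter_upwards [ae_restrict_mem hΩ] with x hx
    simp [hx]
  refine ⟨ρ, hρ, fun k => convolution (η k) (Ω.indicator u) (lsmul ℝ ℝ) volume,
    fun k => convolution (η k) (Ω.indicator G) (lsmul ℝ ℝ) volume, fun k => ?_, fun k => ?_,
    fun k p hp hpz => ?_, conv u hul, conv G hGl⟩
  · exact (hηs k).contDiff_convolution_left (lsmul ℝ ℝ) (hη k) (hul.locallyIntegrable (by norm_num))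
  · exact (hηs k).continuous_convolution_left (lsmul ℝ ℝ) (hη k).continuous
      (hGl.locallyIntegrable (by norm_num))
  · refine hu.gradient_convolution hΩ (hη k) (hηs k) fun t ht => ?_
    apply hcone p hp hpz (ε k) (hε0 k) (hερ k)
    rw [hηdef, (b k).tsupport_normed_eq, mem_closedBall_iff_norm] at ht
    rw [mem_ball_iff_norm]
    have : ‖p - t - (p - ε k • e)‖ = ‖t - ε k • e‖ := by
      rw [← norm_neg]; congr 1; abel
    rw [this]
    have h2 : ‖t - ε k • e‖ ≤ c * ε k / 2 := ht
    have := mul_pos hc (hε0 k)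
    linarith

end Approximation

/-! ### Gluing by a partition of unity -/

section Gluing

theorem tendsto_eLpNorm_of_norm_le_mul {α F F' : Type*} [MeasurableSpace α]
    [NormedAddCommGroup F] [NormedAddCommGroup F'] {μ : Measure α} {R : ℝ} {a : ℕ → α → F}
    {b : ℕ → α → F'} (hab : ∀ k, ∀ᵐ p ∂μ, ‖b k p‖ ≤ R * ‖a k p‖)
    (ha : Tendsto (fun k => eLpNorm (a k) 2 μ) atTop (𝓝 0)) :
    Tendsto (fun k => eLpNorm (b k) 2 μ) atTop (𝓝 0) := by
  have h0 : Tendsto (fun k => ENNReal.ofReal R * eLpNorm (a k) 2 μ) atTop (𝓝 0) := by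
    simpa using ENNReal.Tendsto.const_mul ha (Or.inr ENNReal.ofReal_ne_top)
  exact tendsto_of_tendsto_of_tendsto_of_le_of_le tendsto_const_nhds h0 (fun _ => zero_le)
    fun k => eLpNorm_le_mul_eLpNorm_of_ae_le_mul (hab k) 2

theorem tendsto_eLpNorm_sum {α F ι : Type*} [MeasurableSpace α] [NormedAddCommGroup F]
    [Fintype ι] {μ : Measure α} {a : ι → ℕ → α → F} (ham : ∀ i k, AEStronglyMeasurable (a i k) μ)
    (ha : ∀ i, Tendsto (fun k => eLpNorm (a i k) 2 μ) atTop (𝓝 0)) :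
    Tendsto (fun k => eLpNorm (∑ i, a i k) 2 μ) atTop (𝓝 0) := by
  have h0 : Tendsto (fun k => ∑ i, eLpNorm (a i k) 2 μ) atTop (𝓝 0) := by
    simpa using tendsto_finsetSum Finset.univ fun i _ => ha i
  exact tendsto_of_tendsto_of_tendsto_of_le_of_le tendsto_const_nhds h0 (fun _ => zero_le)
    fun k => eLpNorm_sum_le (fun i _ => ham i k) (by norm_num)

theorem tendsto_eLpNorm_add {α F : Type*} [MeasurableSpace α] [NormedAddCommGroup F]
    {μ : Measure α} {a b : ℕ → α → F} (ham : ∀ k, AEStronglyMeasurable (a k) μ)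
    (hbm : ∀ k, AEStronglyMeasurable (b k) μ)
    (ha : Tendsto (fun k => eLpNorm (a k) 2 μ) atTop (𝓝 0))
    (hb : Tendsto (fun k => eLpNorm (b k) 2 μ) atTop (𝓝 0)) :
    Tendsto (fun k => eLpNorm (a k + b k) 2 μ) atTop (𝓝 0) := by
  have h0 := ha.add hb
  rw [add_zero] at h0
  exact tendsto_of_tendsto_of_tendsto_of_le_of_le tendsto_const_nhds h0 (fun _ => zero_le)
    fun k => eLpNorm_add_le (ham k) (hbm k) (by norm_num)

variable {n : ℕ}

theorem ContDiff.continuous_gradient {f : Eucl n → ℝ} (hf : ContDiff ℝ ∞ f) :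
    Continuous (∇ f) := by
  have : Continuous (fderiv ℝ f) := hf.continuous_fderiv (by simp)
  exact (LinearIsometryEquiv.continuous _).comp this

theorem ContDiff.hasGradientAt {f : Eucl n → ℝ} (hf : ContDiff ℝ ∞ f) (p : Eucl n) :
    HasGradientAt f (∇ f p) p :=
  (hf.differentiable (by simp) p).hasGradientAt

theorem HasGradientAt.fun_sum {ι : Type*} [Fintype ι] {f : ι → Eucl n → ℝ} {g : ι → Eucl n}
    {p : Eucl n} (h : ∀ i, HasGradientAt (f i) (g i) p) :
    HasGradientAt (fun q => ∑ i, f i q) (∑ i, g i) p := by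
  rw [hasGradientAt_iff_hasFDerivAt, map_sum]
  exact HasFDerivAt.fun_sum fun i _ => (h i).hasFDerivAt

theorem HasGradientAt.fun_mul {f g : Eucl n → ℝ} {f' g' p : Eucl n} (hf : HasGradientAt f f' p)
    (hg : HasGradientAt g g' p) :
    HasGradientAt (fun q => f q * g q) (f p • g' + g p • f') p := by
  rw [hasGradientAt_iff_hasFDerivAt, map_add, map_smul, map_smul]
  exact hf.hasFDerivAt.mul hg.hasFDerivAt

open scoped Manifold in
/-- A smooth partition of unity on a closed set, subordinate to a finite open cover. -/
theorem exists_smooth_partition {ι : Type*} [Fintype ι] {K : Set (Eucl n)} (hK : IsClosed K)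
    {U : ι → Set (Eucl n)} (hU : ∀ i, IsOpen (U i)) (hKU : K ⊆ ⋃ i, U i) :
    ∃ χ : ι → Eucl n → ℝ, (∀ i, ContDiff ℝ ∞ (χ i)) ∧ (∀ i p, ‖χ i p‖ ≤ 1) ∧
      (∀ i p, p ∉ U i → χ i p = 0) ∧ ∀ p ∈ K, ∑ i, χ i p = 1 := by
  obtain ⟨f, hf⟩ := SmoothPartitionOfUnity.exists_isSubordinate 𝓘(ℝ, Eucl n) hK U hU hKU
  refine ⟨fun i => f i, fun i => (f i).contMDiff.contDiff, fun i p => ?_, fun i p hp => ?_,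
    fun p hp => ?_⟩
  · rw [Real.norm_of_nonneg (f.nonneg i p)]; exact f.le_one i p
  · exact image_eq_zero_of_notMem_tsupport fun h => hp (hf i h)
  · rw [← finsum_eq_sum_of_fintype]; exact f.sum_eq_one hp

/-- Approximations on the pieces of a cover are glued by a partition of unity `χ`: since
`∑ χ i = 1` on `Ω`, the terms `u ∇(χ i)` produced by the product rule cancel in the limit. -/
theorem tendsto_glue {ι : Type*} [Fintype ι] {Ω : Set (Eucl n)} {u : Eucl n → ℝ}
    {G : Eucl n → Eucl n} (hΩ : IsOpen Ω) (hb : Bornology.IsBounded Ω)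
    (hu : AEStronglyMeasurable u (volume.restrict Ω))
    (hG : AEStronglyMeasurable G (volume.restrict Ω)) {U : ι → Set (Eucl n)}
    {χ : ι → Eucl n → ℝ} (hχ : ∀ i, ContDiff ℝ ∞ (χ i)) (hχ1 : ∀ i p, ‖χ i p‖ ≤ 1)
    (hχ0 : ∀ i p, p ∉ U i → χ i p = 0) (hχsum : ∀ p ∈ Ω, ∑ i, χ i p = 1)
    {W : ι → ℕ → Eucl n → ℝ} {H : ι → ℕ → Eucl n → Eucl n} (hW : ∀ i k, ContDiff ℝ ∞ (W i k))
    (hH : ∀ i k, Continuous (H i k)) (hWH : ∀ i k, ∀ p ∈ Ω, p ∈ U i → ∇ (W i k) p = H i k p)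
    (hWu : ∀ i, Tendsto (fun k => eLpNorm (W i k - u) 2 (volume.restrict Ω)) atTop (𝓝 0))
    (hHG : ∀ i, Tendsto (fun k => eLpNorm (H i k - G) 2 (volume.restrict Ω)) atTop (𝓝 0)) :
    Tendsto (fun k => eLpNorm ((fun p => ∑ i, χ i p * W i k p) - u) 2 (volume.restrict Ω))
      atTop (𝓝 0) ∧
    Tendsto (fun k => eLpNorm (∇ (fun p => ∑ i, χ i p * W i k p) - G) 2 (volume.restrict Ω))
      atTop (𝓝 0) := by
  have hχgrad : ∀ i, Continuous (∇ (χ i)) := fun i => (hχ i).continuous_gradient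
  have hbd : ∀ i, ∃ M : ℝ, ∀ p ∈ Ω, ‖∇ (χ i) p‖ ≤ M := fun i => by
    obtain ⟨M, hM⟩ := hb.isCompact_closure.exists_bound_of_continuousOn (hχgrad i).continuousOn
    exact ⟨M, fun p hp => hM p (subset_closure hp)⟩
  choose M hM using hbd
  have hgradsum : ∀ p ∈ Ω, ∑ i, ∇ (χ i) p = 0 := fun p hp => by
    have h2 : (fun q => ∑ i, χ i q) =ᶠ[𝓝 p] fun _ => 1 := by
      filter_upwards [hΩ.mem_nhds hp] with q hq using hχsum q hq
    exact (HasGradientAt.fun_sum fun i => (hχ i).hasGradientAt p).unique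
      ((hasGradientAt_const p (1 : ℝ)).congr_of_eventuallyEq h2)
  have hvgrad : ∀ k p, ∇ (fun p => ∑ i, χ i p * W i k p) p
      = ∑ i, (χ i p • ∇ (W i k) p + W i k p • ∇ (χ i) p) := fun k p =>
    (HasGradientAt.fun_sum fun i =>
      ((hχ i).hasGradientAt p).fun_mul ((hW i k).hasGradientAt p)).gradient
  have hmem := ae_restrict_mem (μ := volume) hΩ.measurableSet
  have hχm : ∀ i, AEStronglyMeasurable (χ i) (volume.restrict Ω) := fun i =>
    (hχ i).continuous.aestronglyMeasurable
  have hWm : ∀ i k, AEStronglyMeasurable (W i k - u) (volume.restrict Ω) := fun i k =>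
    (hW i k).continuous.aestronglyMeasurable.sub hu
  have hHm : ∀ i k, AEStronglyMeasurable (H i k - G) (volume.restrict Ω) := fun i k =>
    (hH i k).aestronglyMeasurable.sub hG
  have T1 : ∀ i, Tendsto (fun k => eLpNorm (χ i • (W i k - u)) 2 (volume.restrict Ω)) atTop
      (𝓝 0) := fun i => tendsto_eLpNorm_of_norm_le_mul (R := 1) (fun k => ae_of_all _ fun p => by
        rw [Pi.smul_apply', norm_smul]; gcongr; exact hχ1 i p) (hWu i)
  have T2 : ∀ i, Tendsto (fun k => eLpNorm (χ i • (H i k - G)) 2 (volume.restrict Ω)) atTop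
      (𝓝 0) := fun i => tendsto_eLpNorm_of_norm_le_mul (R := 1) (fun k => ae_of_all _ fun p => by
        rw [Pi.smul_apply', norm_smul]; gcongr; exact hχ1 i p) (hHG i)
  have T3 : ∀ i, Tendsto (fun k => eLpNorm ((W i k - u) • ∇ (χ i)) 2 (volume.restrict Ω))
      atTop (𝓝 0) := fun i => tendsto_eLpNorm_of_norm_le_mul (R := M i) (fun k => by
        filter_upwards [hmem] with p hp
        rw [Pi.smul_apply', norm_smul, mul_comm]; gcongr; exact hM i p hp) (hWu i)
  constructor
  · refine (tendsto_eLpNorm_sum (fun i k => (hχm i).smul (hWm i k)) T1).congr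
      fun k => eLpNorm_congr_ae ?_
    filter_upwards [hmem] with p hp
    simp only [Finset.sum_apply, Pi.mul_apply, Pi.sub_apply, smul_eq_mul, mul_sub,
      Finset.sum_sub_distrib, ← Finset.sum_mul, hχsum p hp, one_mul]
  · have hm2 : ∀ i k, AEStronglyMeasurable (χ i • (H i k - G)) (volume.restrict Ω) :=
      fun i k => (hχm i).smul (hHm i k)
    have hm3 : ∀ i k, AEStronglyMeasurable ((W i k - u) • ∇ (χ i)) (volume.restrict Ω) :=
      fun i k => (hWm i k).smul (hχgrad i).aestronglyMeasurable
    refine (tendsto_eLpNorm_sum (fun i k => (hm2 i k).add (hm3 i k)) fun i =>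
      tendsto_eLpNorm_add (hm2 i) (hm3 i) (T2 i) (T3 i)).congr fun k => eLpNorm_congr_ae ?_
    filter_upwards [hmem] with p hp
    have e1 : ∀ i, χ i p • (H i k p - G p) = χ i p • ∇ (W i k) p - χ i p • G p := by
      intro i
      by_cases hpi : p ∈ U i
      · rw [hWH i k p hp hpi, smul_sub]
      · simp [hχ0 i p hpi]
    simp only [Finset.sum_apply, Pi.smul_apply', Pi.sub_apply, Pi.add_apply, hvgrad, e1,
      sub_smul, Finset.sum_add_distrib, Finset.sum_sub_distrib, ← Finset.sum_smul,
      hχsum p hp, ← Finset.smul_sum, hgradsum p hp, smul_zero, one_smul]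
    abel

/-- On a bounded open set with the interior cone condition, functions in `W^{1,2}` are limits of
functions that are smooth on the whole space. -/
theorem IsSobolevW12.exists_contDiff_approx {Ω : Set (Eucl n)} {u : Eucl n → ℝ}
    {G : Eucl n → Eucl n} (hΩ : IsOpen Ω) (hb : Bornology.IsBounded Ω)
    (hcone : ∀ z ∈ closure Ω, HasInteriorConeAt Ω z) (hu : IsSobolevW12 Ω u G) :
    ∃ v : ℕ → Eucl n → ℝ, (∀ k, ContDiff ℝ ∞ (v k)) ∧
      Tendsto (fun k => eLpNorm (v k - u) 2 (volume.restrict Ω)) atTop (𝓝 0) ∧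
      Tendsto (fun k => eLpNorm (∇ (v k) - G) 2 (volume.restrict Ω)) atTop (𝓝 0) := by
  choose! ρ hρ W H hW hHc hWH hWu hHG using fun z hz =>
    hu.exists_local_approx hΩ.measurableSet (hcone z hz)
  obtain ⟨t, htK, ht⟩ := hb.isCompact_closure.elim_nhds_subcover
    (fun z => Metric.ball z (ρ z)) fun z hz => Metric.ball_mem_nhds z (hρ z hz)
  have hcov : closure Ω ⊆ ⋃ i : t, Metric.ball (i : Eucl n) (ρ i) := by
    refine ht.trans fun y hy => ?_
    simp only [Set.mem_iUnion] at hy ⊢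
    obtain ⟨z, hz, hy⟩ := hy
    exact ⟨⟨z, hz⟩, hy⟩
  obtain ⟨χ, hχ, hχ1, hχ0, hχsum⟩ := exists_smooth_partition isClosed_closure
    (fun i : t => Metric.isOpen_ball (x := (i : Eucl n)) (ε := ρ i)) hcov
  have hti : ∀ i : t, (i : Eucl n) ∈ closure Ω := fun i => htK i i.2
  exact ⟨fun k p => ∑ i, χ i p * W i k p,
    fun k => ContDiff.sum fun i _ => (hχ i).mul (hW i (hti i) k),
    tendsto_glue hΩ hb hu.memLp.1 hu.memLp_grad.1 hχ hχ1 hχ0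
      (fun p hp => hχsum p (subset_closure hp)) (fun i k => hW i (hti i) k)
      (fun i k => hHc i (hti i) k) (fun i k p hp hpi => hWH i (hti i) k p hp hpi)
      (fun i => hWu i (hti i)) (fun i => hHG i (hti i))⟩

end Gluing

/-! ### Normal coordinates near a hypersurface -/

section LocalGeometry

variable {n : ℕ} {S : Set (Eucl n)} {ν : Eucl n → Eucl n}

/-- Local data for `(S, ν)` at `x`: a defining function `φ` of `S` together with a differentiable
unit field `N` that extends `ν` off `S` and is parallel to `∇ φ`. -/
structure IsNormalExtensionAt (S : Set (Eucl n)) (ν : Eucl n → Eucl n) (φ : Eucl n → ℝ)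
    (N : Eucl n → Eucl n) (x : Eucl n) : Prop where
  contDiff : ContDiff ℝ ∞ φ
  gradient_ne_zero : ∇ φ x ≠ 0
  mem_iff : ∀ᶠ y in 𝓝 x, (y ∈ S ↔ φ y = 0)
  contDiffAt : ContDiffAt ℝ 1 N x
  norm_eq_one : ∀ᶠ y in 𝓝 x, ‖N y‖ = 1
  gradient_eq : ∇ φ x = ‖∇ φ x‖ • N x
  eq_normal : ∀ᶠ y in 𝓝 x, y ∈ S → ν y = N y

/-- One pair `(φ, N)` serves all points near a given point of `S`, which is what makes the radius
of the normal coordinates locally uniform. -/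
theorem IsUnitNormalField.exists_extension (hν : IsUnitNormalField S ν) {x : Eucl n}
    (hx : x ∈ S) : ∃ φ N, ∀ᶠ y in 𝓝 x, IsNormalExtensionAt S ν φ N y := by
  obtain ⟨φ, ⟨hφ, hφ0, hφS⟩, hφν⟩ := hν x hx
  have hgc : ContDiff ℝ 1 (∇ φ) := by
    have h1 : ContDiff ℝ 1 (fderiv ℝ φ) :=
      (contDiff_infty_iff_fderiv.1 hφ).2.of_le (by exact_mod_cast le_top)
    exact (InnerProductSpace.toDual ℝ (Eucl n)).symm.contDiff.comp h1
  have hne : ∀ᶠ y in 𝓝 x, ∇ φ y ≠ 0 := hgc.continuous.continuousAt.eventually_ne hφ0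
  have hN1 : ∀ {y}, ∇ φ y ≠ 0 → ‖‖∇ φ y‖⁻¹ • ∇ φ y‖ = 1 := fun {y} hy => by
    rw [norm_smul, norm_inv, norm_norm, inv_mul_cancel₀ (norm_ne_zero_iff.2 hy)]
  refine ⟨φ, fun y => ‖∇ φ y‖⁻¹ • ∇ φ y, ?_⟩
  filter_upwards [hne, hne.eventually_nhds, hφS.eventually_nhds,
    (eventually_nhdsWithin_iff.1 hφν).eventually_nhds] with y hy hy' hyS hyν
  refine ⟨hφ, hy, hyS, ?_, ?_, ?_, hyν⟩
  · exact ((hgc.contDiffAt.norm ℝ hy).inv (norm_ne_zero_iff.2 hy)).smul hgc.contDiffAt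
  · filter_upwards [hy'] with w hw using hN1 hw
  · rw [smul_smul, mul_inv_cancel₀ (norm_ne_zero_iff.2 hy), one_smul]

variable {φ : Eucl n → ℝ} {N : Eucl n → Eucl n} {x : Eucl n}

/-- Secants of `S` near `x` are almost orthogonal to the normal at `x`. -/
theorem IsNormalExtensionAt.eventually_inner_le (h : IsNormalExtensionAt S ν φ N x) (hx : x ∈ S)
    {η : ℝ} (hη : 0 < η) : ∀ᶠ p : Eucl n × Eucl n in 𝓝 (x, x), p.1 ∈ S → p.2 ∈ S →
      |inner ℝ (p.1 - p.2) (ν x)| ≤ η * ‖p.1 - p.2‖ := by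
  have hs : HasStrictFDerivAt φ (fderiv ℝ φ x) x :=
    (h.contDiff.contDiffAt (x := x)).hasStrictFDerivAt (by simp)
  have hg : 0 < ‖∇ φ x‖ := norm_pos_iff.2 h.gradient_ne_zero
  have hb := hs.isLittleO.bound (mul_pos hη hg)
  have hm := h.mem_iff
  filter_upwards [hb, (continuous_fst.tendsto' (x, x) x rfl).eventually hm,
    (continuous_snd.tendsto' (x, x) x rfl).eventually hm] with p hp h1 h2 hp1 hp2
  rw [h1.1 hp1, h2.1 hp2, sub_zero, zero_sub, norm_neg, ← inner_gradient_left, h.gradient_eq,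
    inner_smul_left, norm_mul, ← h.eq_normal.self_of_nhds hx, real_inner_comm] at hp
  have h1 : ‖ν x‖ = 1 := by rw [h.eq_normal.self_of_nhds hx, h.norm_eq_one.self_of_nhds]
  simp only [conj_trivial, norm_smul, h1, Real.norm_eq_abs, abs_of_pos hg] at hp
  refine le_of_mul_le_mul_left (hp.trans (le_of_eq ?_)) hg
  ring

/-- The derivative of a unit field is orthogonal to the field. -/
theorem IsNormalExtensionAt.inner_fderiv (h : IsNormalExtensionAt S ν φ N x) (v : Eucl n) :
    inner ℝ (fderiv ℝ N x v) (N x) = 0 := by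
  have hd : HasFDerivAt N (fderiv ℝ N x) x := (h.contDiffAt.differentiableAt (by simp)).hasFDerivAt
  have h1 := hd.inner ℝ hd
  have h2 : (fun y => inner ℝ (N y) (N y)) =ᶠ[𝓝 x] fun _ => (1 : ℝ) := by
    filter_upwards [h.norm_eq_one] with y hy
    rw [real_inner_self_eq_norm_sq, hy]; norm_num
  have h3 := h1.unique ((hasFDerivAt_const (1 : ℝ) x).congr_of_eventuallyEq h2)
  have h4 := congrArg (fun L => L v) h3
  simp [real_inner_comm] at h4
  have h5 : (2 : ℝ) * inner ℝ (N x) (fderiv ℝ N x v) = 0 := by linarith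
  rw [real_inner_comm]
  linarith

/-- Fermi coordinates near `x + t ν(x)`: differentiable maps `π`, `d` that recover the foot point
and the signed distance in `p = π(p) + d(p) ν(π(p))`. -/
def HasNormalCoordinatesAt (S : Set (Eucl n)) (ν : Eucl n → Eucl n) (x : Eucl n) (t : ℝ) : Prop :=
  ∃ (π : Eucl n → Eucl n) (d : Eucl n → ℝ) (π' : Eucl n →L[ℝ] Eucl n) (d' : Eucl n →L[ℝ] ℝ),
    HasStrictFDerivAt π π' (x + t • ν x) ∧ HasStrictFDerivAt d d' (x + t • ν x) ∧
    π (x + t • ν x) = x ∧ d (x + t • ν x) = t ∧ π' (ν x) = 0 ∧ d' (ν x) = 1 ∧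
    ∀ᶠ p in 𝓝 (x + t • ν x), π p ∈ S ∧ π p + d p • ν (π p) = p

/-- The inverse function theorem is applied to `(y, s) ↦ (y + s N(y), φ y)`, whose restriction to
`φ = 0` parametrizes a neighbourhood by `S × ℝ`. -/
theorem IsNormalExtensionAt.hasNormalCoordinatesAt (h : IsNormalExtensionAt S ν φ N x)
    (hx : x ∈ S) {t : ℝ} (ht : |t| * ‖fderiv ℝ N x‖ < 1) : HasNormalCoordinatesAt S ν x t := by
  have hνx : ν x = N x := h.eq_normal.self_of_nhds hx
  have hφx : φ x = 0 := h.mem_iff.self_of_nhds.1 hx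
  have hN1 : ‖N x‖ = 1 := h.norm_eq_one.self_of_nhds
  have hNs : HasStrictFDerivAt N (fderiv ℝ N x) x := h.contDiffAt.hasStrictFDerivAt (by simp)
  have hφs : HasStrictFDerivAt φ (fderiv ℝ φ x) x :=
    (h.contDiff.contDiffAt (x := x)).hasStrictFDerivAt (by simp)
  let Φ : Eucl n × ℝ → Eucl n × ℝ := fun q => (q.1 + q.2 • N q.1, φ q.1)
  have hfst : HasStrictFDerivAt (fun q : Eucl n × ℝ => q.1)
      (ContinuousLinearMap.fst ℝ (Eucl n) ℝ) (x, t) := hasStrictFDerivAt_fst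
  have hsnd : HasStrictFDerivAt (fun q : Eucl n × ℝ => q.2)
      (ContinuousLinearMap.snd ℝ (Eucl n) ℝ) (x, t) := hasStrictFDerivAt_snd
  have hNc : HasStrictFDerivAt (fun q : Eucl n × ℝ => N q.1)
      ((fderiv ℝ N x).comp (ContinuousLinearMap.fst ℝ (Eucl n) ℝ)) (x, t) :=
    HasStrictFDerivAt.comp (x, t) (g := N) hNs hfst
  have hφc : HasStrictFDerivAt (fun q : Eucl n × ℝ => φ q.1)
      ((fderiv ℝ φ x).comp (ContinuousLinearMap.fst ℝ (Eucl n) ℝ)) (x, t) :=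
    HasStrictFDerivAt.comp (x, t) (g := φ) hφs hfst
  obtain ⟨A, hA, hAv⟩ : ∃ A : Eucl n × ℝ →L[ℝ] Eucl n × ℝ, HasStrictFDerivAt Φ A (x, t) ∧
      ∀ v τ, A (v, τ) = (v + (t • fderiv ℝ N x v + τ • N x), fderiv ℝ φ x v) :=
    ⟨_, (hfst.add (hsnd.smul hNc)).prodMk hφc, fun v τ => by simp⟩
  have hgrad : ∀ v, fderiv ℝ φ x v = ‖∇ φ x‖ * inner ℝ v (N x) := fun v => by
    rw [← inner_gradient_left, h.gradient_eq, inner_smul_left, norm_smul, hN1, real_inner_comm]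
    simp
  have hinj : Function.Injective A := by
    rw [injective_iff_map_eq_zero]
    rintro ⟨v, τ⟩ hv
    rw [hAv, Prod.mk_eq_zero, hgrad] at hv
    have hv0 : inner ℝ v (N x) = 0 :=
      (mul_eq_zero.1 hv.2).resolve_left (norm_ne_zero_iff.2 h.gradient_ne_zero)
    have hτ : τ = 0 := by
      have := congrArg (fun w => inner ℝ w (N x)) hv.1
      simpa [inner_add_left, inner_smul_left, hv0, h.inner_fderiv, hN1] using this
    have hv1 : v = -(t • fderiv ℝ N x v) := by
      have := hv.1
      rw [hτ, zero_smul, add_zero] at this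
      exact eq_neg_of_add_eq_zero_left this
    have hv2 : ‖v‖ ≤ |t| * ‖fderiv ℝ N x‖ * ‖v‖ := by
      calc ‖v‖ = ‖t • fderiv ℝ N x v‖ := by conv_lhs => rw [hv1, norm_neg]
        _ ≤ |t| * (‖fderiv ℝ N x‖ * ‖v‖) := by
          rw [norm_smul, Real.norm_eq_abs]; gcongr; exact ContinuousLinearMap.le_opNorm _ _
        _ = _ := by ring
    have hv3 : ‖v‖ = 0 := by
      by_contra hne
      have : 0 < ‖v‖ := lt_of_le_of_ne (norm_nonneg _) (Ne.symm hne)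
      nlinarith
    rw [norm_eq_zero.1 hv3, hτ]; rfl
  let Ae : (Eucl n × ℝ) ≃L[ℝ] (Eucl n × ℝ) :=
    (LinearEquiv.ofInjectiveEndo (A : Eucl n × ℝ →ₗ[ℝ] Eucl n × ℝ) hinj).toContinuousLinearEquiv
  have hAe : HasStrictFDerivAt Φ (Ae : Eucl n × ℝ →L[ℝ] Eucl n × ℝ) (x, t) := by
    have : (Ae : Eucl n × ℝ →L[ℝ] Eucl n × ℝ) = A := ContinuousLinearMap.ext fun _ => rfl
    rwa [this]
  have hΦx : Φ (x, t) = (x + t • ν x, 0) := by simp [Φ, hνx, hφx]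
  have hinv := hAe.to_localInverse
  have hright := hAe.eventually_right_inverse
  rw [hΦx] at hinv hright
  set inv := hAe.localInverse with hinvdef
  have hinvx : inv (x + t • ν x, 0) = (x, t) := by rw [← hΦx]; exact hAe.localInverse_apply_image
  have hι : HasStrictFDerivAt (fun p : Eucl n => (p, (0 : ℝ)))
      (ContinuousLinearMap.inl ℝ (Eucl n) ℝ) (x + t • ν x) :=
    (hasStrictFDerivAt_id _).prodMk (hasStrictFDerivAt_const _ _)
  have hc : HasStrictFDerivAt (fun p => inv (p, 0)) ((Ae.symm : Eucl n × ℝ →L[ℝ] Eucl n × ℝ).comp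
      (ContinuousLinearMap.inl ℝ (Eucl n) ℝ)) (x + t • ν x) :=
    HasStrictFDerivAt.comp (x + t • ν x) (g := inv) hinv hι
  have hsymm : Ae.symm (ν x, 0) = (0, 1) := by
    rw [ContinuousLinearEquiv.symm_apply_eq]
    change _ = A (0, 1)
    rw [hAv]; simp [hνx]
  refine ⟨fun p => (inv (p, 0)).1, fun p => (inv (p, 0)).2, _, _, hc.fst, hc.snd,
    ?_, ?_, ?_, ?_, ?_⟩
  · simp [hinvx]
  · simp [hinvx]
  · simp [hsymm]
  · simp [hsymm]
  · have hcont : Tendsto (fun p => (inv (p, 0)).1) (𝓝 (x + t • ν x)) (𝓝 x) := by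
      have := hc.fst.continuousAt.tendsto
      simpa [hinvx] using this
    have hιc : Tendsto (fun p : Eucl n => (p, (0 : ℝ))) (𝓝 (x + t • ν x))
        (𝓝 (x + t • ν x, 0)) := hι.continuousAt.tendsto
    filter_upwards [hιc.eventually hright, hcont.eventually h.mem_iff,
      hcont.eventually h.eq_normal] with p hp1 hp2 hp3
    have hp1' : ((inv (p, 0)).1 + (inv (p, 0)).2 • N (inv (p, 0)).1, φ (inv (p, 0)).1) = (p, 0) :=
      hp1
    have hmem := hp2.2 (Prod.ext_iff.1 hp1').2
    exact ⟨hmem, by rw [hp3 hmem]; exact (Prod.ext_iff.1 hp1').1⟩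

/-- Normal coordinates exist in a tube of uniform radius around a compact hypersurface. -/
theorem IsUnitNormalField.exists_hasNormalCoordinatesAt (hS : IsCompact S)
    (hν : IsUnitNormalField S ν) :
    ∃ r > 0, ∀ x ∈ S, ∀ t : ℝ, |t| < r → HasNormalCoordinatesAt S ν x t := by
  refine hS.induction_on (p := fun s => ∃ r > 0, ∀ x ∈ s, ∀ t : ℝ, |t| < r →
    HasNormalCoordinatesAt S ν x t) ⟨1, one_pos, by simp⟩ ?_ ?_ ?_
  · rintro s t hst ⟨r, hr, h⟩
    exact ⟨r, hr, fun x hx => h x (hst hx)⟩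
  · rintro s t ⟨r, hr, h⟩ ⟨r', hr', h'⟩
    refine ⟨min r r', lt_min hr hr', fun x hx t ht => ?_⟩
    rcases hx with hx | hx
    · exact h x hx t (ht.trans_le (min_le_left _ _))
    · exact h' x hx t (ht.trans_le (min_le_right _ _))
  · intro x hx
    obtain ⟨φ, N, h⟩ := hν.exists_extension hx
    have hc : ContinuousAt (fderiv ℝ N) x :=
      h.self_of_nhds.contDiffAt.continuousAt_fderiv (by simp)
    have hlt : ∀ᶠ y in 𝓝 x, ‖fderiv ℝ N y‖ < ‖fderiv ℝ N x‖ + 1 :=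
      hc.norm.eventually (gt_mem_nhds (lt_add_one _))
    have hM : 0 < ‖fderiv ℝ N x‖ + 1 := by positivity
    refine ⟨_, inter_mem_nhdsWithin S (h.and hlt), (‖fderiv ℝ N x‖ + 1)⁻¹, by positivity, ?_⟩
    rintro y ⟨hyS, hy, hyl⟩ t ht
    refine hy.hasNormalCoordinatesAt hyS ?_
    calc |t| * ‖fderiv ℝ N y‖ ≤ |t| * (‖fderiv ℝ N x‖ + 1) := by gcongr
      _ < (‖fderiv ℝ N x‖ + 1)⁻¹ * (‖fderiv ℝ N x‖ + 1) := by gcongr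
      _ = 1 := inv_mul_cancel₀ hM.ne'

end LocalGeometry

/-! ### The tube around a compact hypersurface -/

section Tube

variable {n : ℕ} {S : Set (Eucl n)} {ν : Eucl n → Eucl n}

/-- Quantitative control of the tube of radius `r` around `S`: the unit field `ν` is `K`-Lipschitz,
secants of length at most `8 r` make an angle with `ν` that is bounded away from zero, the radius is
small compared with the curvature bound `K`, and normal coordinates exist in the tube. -/
structure HasTube (S : Set (Eucl n)) (ν : Eucl n → Eucl n) (K r : ℝ) : Prop where
  K_nonneg : 0 ≤ K
  r_pos : 0 < r
  norm_eq_one : ∀ x ∈ S, ‖ν x‖ = 1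
  normal_sub_le : ∀ x ∈ S, ∀ y ∈ S, ‖ν x - ν y‖ ≤ K * ‖x - y‖
  inner_le : ∀ x ∈ S, ∀ y ∈ S, ‖x - y‖ ≤ 8 * r → |inner ℝ (x - y) (ν x)| ≤ 1 / 4 * ‖x - y‖
  mul_le : r * K ≤ 1 / 4
  coords : ∀ x ∈ S, ∀ t : ℝ, |t| < r → HasNormalCoordinatesAt S ν x t

theorem IsUnitNormalField.norm_eq_one (hν : IsUnitNormalField S ν) {x : Eucl n} (hx : x ∈ S) :
    ‖ν x‖ = 1 := by
  obtain ⟨φ, N, h⟩ := hν.exists_extension hx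
  rw [h.self_of_nhds.eq_normal.self_of_nhds hx, h.self_of_nhds.norm_eq_one.self_of_nhds]

theorem IsUnitNormalField.exists_lipschitzOnWith (hS : IsCompact S) (hν : IsUnitNormalField S ν) :
    ∃ K, LipschitzOnWith K ν S := by
  refine LocallyLipschitzOn.exists_lipschitzOnWith_of_compact hS fun x hx => ?_
  obtain ⟨φ, N, h⟩ := hν.exists_extension hx
  obtain ⟨K, t, ht, hK⟩ := h.self_of_nhds.contDiffAt.exists_lipschitzOnWith
  refine ⟨K, S ∩ (t ∩ {y | y ∈ S → ν y = N y}),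
    inter_mem_nhdsWithin S (inter_mem ht h.self_of_nhds.eq_normal), ?_⟩
  intro y hy z hz
  rw [hy.2.2 hy.1, hz.2.2 hz.1]
  exact hK hy.2.1 hz.2.1

/-- The local secant estimate is uniform on `S`, by a Lebesgue number argument. -/
theorem IsUnitNormalField.exists_inner_le (hS : IsCompact S) (hν : IsUnitNormalField S ν) {K : ℝ}
    (hK : 0 ≤ K) (hlip : ∀ x ∈ S, ∀ y ∈ S, ‖ν x - ν y‖ ≤ K * ‖x - y‖) :
    ∃ δ > 0, ∀ x ∈ S, ∀ y ∈ S, ‖x - y‖ < δ → |inner ℝ (x - y) (ν x)| ≤ 1 / 4 * ‖x - y‖ := by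
  have key : ∀ x ∈ S, ∃ ρ > 0, ∀ y ∈ S, ∀ w ∈ S, ‖y - x‖ < ρ → ‖w - x‖ < ρ →
      |inner ℝ (y - w) (ν y)| ≤ 1 / 4 * ‖y - w‖ := by
    intro x hx
    obtain ⟨φ, N, h⟩ := hν.exists_extension hx
    obtain ⟨ρ, hρ, hρ'⟩ := Metric.eventually_nhds_iff.1
      (h.self_of_nhds.eventually_inner_le hx (η := 1 / 8) (by norm_num))
    refine ⟨min ρ (1 / (8 * (K + 1))), lt_min hρ (by positivity), fun y hy w hw hyx hwx => ?_⟩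
    have h1 : |inner ℝ (y - w) (ν x)| ≤ 1 / 8 * ‖y - w‖ := by
      refine hρ' (y := (y, w)) ?_ hy hw
      rw [Prod.dist_eq, max_lt_iff, dist_eq_norm, dist_eq_norm]
      exact ⟨hyx.trans_le (min_le_left _ _), hwx.trans_le (min_le_left _ _)⟩
    have h2 : ‖ν y - ν x‖ ≤ 1 / 8 := by
      refine (hlip y hy x hx).trans ?_
      have h3 : ‖y - x‖ ≤ 1 / (8 * (K + 1)) := (hyx.trans_le (min_le_right _ _)).le
      calc K * ‖y - x‖ ≤ (K + 1) * (1 / (8 * (K + 1))) := by gcongr; linarith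
        _ = 1 / 8 := by field_simp
    have h4 : inner ℝ (y - w) (ν y) = inner ℝ (y - w) (ν x) + inner ℝ (y - w) (ν y - ν x) := by
      rw [inner_sub_right]; ring
    calc |inner ℝ (y - w) (ν y)| ≤ |inner ℝ (y - w) (ν x)| + |inner ℝ (y - w) (ν y - ν x)| := by
          rw [h4]; exact abs_add_le _ _
      _ ≤ 1 / 8 * ‖y - w‖ + ‖y - w‖ * (1 / 8) := by
          gcongr; exact (abs_real_inner_le_norm _ _).trans (by gcongr)
      _ = 1 / 4 * ‖y - w‖ := by ring
  choose! ρ hρ hρ' using key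
  obtain ⟨δ, hδ, hδ'⟩ := lebesgue_number_lemma_of_metric hS
    (c := fun x : S => Metric.ball (x : Eucl n) (ρ x)) (fun _ => Metric.isOpen_ball)
    (fun x hx => Set.mem_iUnion.2 ⟨⟨x, hx⟩, Metric.mem_ball_self (hρ x hx)⟩)
  refine ⟨δ, hδ, fun x hx y hy hxy => ?_⟩
  obtain ⟨i, hi⟩ := hδ' x hx
  refine hρ' i i.2 x hx y hy ?_ ?_
  · exact mem_ball_iff_norm.1 (hi (Metric.mem_ball_self hδ))
  · exact mem_ball_iff_norm.1 (hi (by rwa [mem_ball_iff_norm, norm_sub_rev]))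

theorem IsUnitNormalField.exists_hasTube (hS : IsCompact S) (hν : IsUnitNormalField S ν) :
    ∃ K r, HasTube S ν K r := by
  obtain ⟨K, hK⟩ := hν.exists_lipschitzOnWith hS
  have hlip : ∀ x ∈ S, ∀ y ∈ S, ‖ν x - ν y‖ ≤ K * ‖x - y‖ := fun x hx y hy => by
    simpa [dist_eq_norm] using hK.dist_le_mul x hx y hy
  obtain ⟨δ, hδ, hδ'⟩ := hν.exists_inner_le hS K.2 hlip
  obtain ⟨ρ, hρ, hρ'⟩ := hν.exists_hasNormalCoordinatesAt hS
  have hK1 : (0 : ℝ) < 4 * (K + 1) := by positivity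
  -- `δ / 16` keeps secants of length `8 r` strictly below `δ`; `K + 1` allows `K = 0`
  refine ⟨K, min ρ (min (δ / 16) (1 / (4 * (K + 1)))), K.2, by positivity,
    fun x hx => hν.norm_eq_one hx, hlip, fun x hx y hy hxy => hδ' x hx y hy ?_, ?_,
    fun x hx t ht => hρ' x hx t (ht.trans_le (min_le_left _ _))⟩
  · have : min ρ (min (δ / 16) (1 / (4 * ((K : ℝ) + 1)))) ≤ δ / 16 :=
      (min_le_right _ _).trans (min_le_left _ _)
    linarith
  · calc min ρ (min (δ / 16) (1 / (4 * ((K : ℝ) + 1)))) * (K : ℝ)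
        ≤ (1 / (4 * ((K : ℝ) + 1))) * (K + 1) := by
          gcongr
          · exact (min_le_right _ _).trans (min_le_right _ _)
          · linarith
      _ = 1 / 4 := by field_simp

variable {K r : ℝ}

/-- The normal map `(x, t) ↦ x + t ν(x)` is bi-Lipschitz at small scales. -/
theorem HasTube.norm_sub_le_two_mul (h : HasTube S ν K r) {x y : Eucl n} (hx : x ∈ S) (hy : y ∈ S)
    (hxy : ‖x - y‖ ≤ 8 * r) {t s : ℝ} (hs : |s| ≤ r) :
    ‖x - y‖ ≤ 2 * ‖(x + t • ν x) - (y + s • ν y)‖ ∧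
      |t - s| ≤ 2 * ‖(x + t • ν x) - (y + s • ν y)‖ := by
  set a := ‖x - y‖ with ha
  set b := |t - s| with hb
  set q := ‖(x - y) + (t - s) • ν x‖ with hq
  have ha0 : 0 ≤ a := norm_nonneg _
  have hb0 : 0 ≤ b := abs_nonneg _
  have hq0 : 0 ≤ q := norm_nonneg _
  have h1 : q ^ 2 = a ^ 2 + 2 * ((t - s) * inner ℝ (x - y) (ν x)) + b ^ 2 := by
    rw [hq, norm_add_sq_real, inner_smul_right, norm_smul, h.norm_eq_one x hx, mul_one,
      Real.norm_eq_abs]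
  have h2 : |(t - s) * inner ℝ (x - y) (ν x)| ≤ b * (1 / 4 * a) := by
    rw [abs_mul]; gcongr; exact h.inner_le x hx y hy hxy
  have h3 : 3 / 4 * (a ^ 2 + b ^ 2) ≤ q ^ 2 := by
    have := (abs_le.1 h2).1
    nlinarith [sq_nonneg (a - b)]
  have h4 : q ≤ ‖(x + t • ν x) - (y + s • ν y)‖ + a / 4 := by
    have e : (x - y) + (t - s) • ν x
        = ((x + t • ν x) - (y + s • ν y)) - s • (ν x - ν y) := by
      rw [sub_smul, smul_sub]; abel
    rw [hq, e]
    refine (norm_sub_le _ _).trans ?_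
    gcongr
    calc ‖s • (ν x - ν y)‖ = |s| * ‖ν x - ν y‖ := by rw [norm_smul, Real.norm_eq_abs]
      _ ≤ r * (K * a) := by
        have := h.r_pos
        gcongr; exact h.normal_sub_le x hx y hy
      _ = (r * K) * a := by ring
      _ ≤ 1 / 4 * a := by gcongr; exact h.mul_le
      _ = a / 4 := by ring
  have h5 : 3 / 4 * a ≤ q := by
    refine (pow_le_pow_iff_left₀ (by positivity) hq0 two_ne_zero).1 ?_
    nlinarith [sq_nonneg b, sq_nonneg a]
  have h6 : 1 / 2 * b + 1 / 4 * a ≤ q := by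
    refine (pow_le_pow_iff_left₀ (by positivity) hq0 two_ne_zero).1 ?_
    nlinarith [sq_nonneg (a - b), sq_nonneg a, sq_nonneg b]
  constructor <;> linarith

/-- The normal map is injective on `S × [-r, r]`: two points of `S` with a common image have
distance at most `8 r`, so the bi-Lipschitz bound applies. -/
theorem HasTube.injective (h : HasTube S ν K r) {x y : Eucl n} (hx : x ∈ S) (hy : y ∈ S)
    {t s : ℝ} (ht : |t| ≤ r) (hs : |s| ≤ r) (heq : x + t • ν x = y + s • ν y) : x = y ∧ t = s := by
  have hxy : ‖x - y‖ ≤ 8 * r := by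
    have e : x - y = s • ν y - t • ν x := by
      rw [sub_eq_sub_iff_add_eq_add, heq, add_comm]
    have hr := h.r_pos
    calc ‖x - y‖ ≤ ‖s • ν y‖ + ‖t • ν x‖ := by rw [e]; exact norm_sub_le _ _
      _ = |s| + |t| := by
        rw [norm_smul, norm_smul, h.norm_eq_one x hx, h.norm_eq_one y hy, mul_one, mul_one,
          Real.norm_eq_abs, Real.norm_eq_abs]
      _ ≤ 8 * r := by linarith
  have := h.norm_sub_le_two_mul hx hy hxy (t := t) hs
  rw [heq, sub_self, norm_zero, mul_zero] at this
  exact ⟨sub_eq_zero.1 (norm_le_zero_iff.1 this.1), sub_eq_zero.1 (abs_nonpos_iff.1 this.2)⟩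

theorem HasNormalCoordinatesAt.neg {x : Eucl n} {t : ℝ} (h : HasNormalCoordinatesAt S ν x (-t)) :
    HasNormalCoordinatesAt S (-ν) x t := by
  obtain ⟨π, d, π', d', hπ, hd, hπx, hdx, hπ', hd', hev⟩ := h
  have e : x + t • (-ν) x = x + (-t) • ν x := by simp
  rw [HasNormalCoordinatesAt, e]
  refine ⟨π, -d, π', -d', hπ, hd.neg, hπx, ?_, ?_, ?_, ?_⟩
  · rw [Pi.neg_apply, hdx, neg_neg]
  · rw [Pi.neg_apply, map_neg, hπ', neg_zero]
  · simpa using hd'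
  · simpa using hev

theorem HasTube.neg (h : HasTube S ν K r) : HasTube S (-ν) K r where
  K_nonneg := h.K_nonneg
  r_pos := h.r_pos
  norm_eq_one x hx := by simpa using h.norm_eq_one x hx
  normal_sub_le x hx y hy := by
    rw [Pi.neg_apply, Pi.neg_apply, neg_sub_neg, norm_sub_rev]; exact h.normal_sub_le x hx y hy
  inner_le x hx y hy hxy := by simpa using h.inner_le x hx y hy hxy
  mul_le := h.mul_le
  coords x hx t ht := (h.coords x hx (-t) (by rwa [abs_neg])).neg

theorem thinShell_neg (g₁ g₂ : Eucl n → ℝ) : thinShell S (-ν) g₂ g₁ = thinShell S ν g₁ g₂ := by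
  ext z
  constructor
  · rintro ⟨x, hx, t, h1, h2, rfl⟩
    exact ⟨x, hx, -t, by linarith, by linarith, by simp⟩
  · rintro ⟨x, hx, t, h1, h2, rfl⟩
    exact ⟨x, hx, -t, by linarith, by linarith, by simp⟩

end Tube

/-! ### Openness, frontier and cone condition of the shell -/

section Shell

variable {n : ℕ} {S : Set (Eucl n)} {ν : Eucl n → Eucl n} {K r : ℝ} {g₁ g₂ : Eucl n → ℝ}

theorem IsSmoothOnSurface.continuousOn {g : Eucl n → ℝ} (hg : IsSmoothOnSurface S g) :
    ContinuousOn g S := fun x hx => by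
  obtain ⟨G, hG, hGg⟩ := hg x hx
  exact hG.continuous.continuousWithinAt.congr_of_eventuallyEq hGg.symm
    (hGg.self_of_nhdsWithin hx).symm

theorem HasTube.continuousOn (hT : HasTube S ν K r) : ContinuousOn ν S :=
  (LipschitzOnWith.of_dist_le_mul (K := ⟨K, hT.K_nonneg⟩) fun x hx y hy => by
    rw [dist_eq_norm, dist_eq_norm]; exact hT.normal_sub_le x hx y hy).continuousOn

theorem HasTube.isOpen_thinShell (hT : HasTube S ν K r) (hg₁ : ContinuousOn g₁ S)
    (hg₂ : ContinuousOn g₂ S) (h₁ : ∀ x ∈ S, g₁ x < r) (h₂ : ∀ x ∈ S, g₂ x < r) :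
    IsOpen (thinShell S ν g₁ g₂) := by
  rw [isOpen_iff_mem_nhds]
  rintro z ⟨x, hx, t, ht1, ht2, rfl⟩
  obtain ⟨π, d, π', d', hπ, hd, hπx, hdx, -, -, hev⟩ := hT.coords x hx t
    (abs_lt.2 ⟨by linarith [h₁ x hx], by linarith [h₂ x hx]⟩)
  have hπc : Tendsto π (𝓝 (x + t • ν x)) (𝓝[S] x) := by
    refine tendsto_nhdsWithin_iff.2 ⟨?_, hev.mono fun p hp => hp.1⟩
    have := hπ.continuousAt.tendsto
    rwa [hπx] at this
  have hdc : Tendsto d (𝓝 (x + t • ν x)) (𝓝 t) := by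
    have := hd.continuousAt.tendsto
    rwa [hdx] at this
  have hb1 := ((hg₁ x hx).tendsto.comp hπc).neg.eventually_lt hdc ht1
  have hb2 := hdc.eventually_lt ((hg₂ x hx).tendsto.comp hπc) ht2
  filter_upwards [hev, hb1, hb2] with p hp h1 h2
  exact ⟨π p, hp.1, d p, h1, h2, hp.2.symm⟩

theorem closure_thinShell_subset (hS : IsCompact S) (hν : ContinuousOn ν S)
    (hg₁ : ContinuousOn g₁ S) (hg₂ : ContinuousOn g₂ S) (h₁ : ∀ x ∈ S, 0 < g₁ x)
    (h₂ : ∀ x ∈ S, 0 < g₂ x) {z : Eucl n} (hz : z ∈ closure (thinShell S ν g₁ g₂)) :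
    ∃ x ∈ S, ∃ t, -g₁ x ≤ t ∧ t ≤ g₂ x ∧ z = x + t • ν x := by
  let f : Eucl n × ℝ → Eucl n := fun q => q.1 + ((1 - q.2) * (-g₁ q.1) + q.2 * g₂ q.1) • ν q.1
  have hfc : ContinuousOn f (S ×ˢ Set.Icc (0 : ℝ) 1) := by
    have hm : Set.MapsTo Prod.fst (S ×ˢ Set.Icc (0 : ℝ) 1) S := fun q hq => hq.1
    have c1 := hg₁.comp continuousOn_fst hm
    have c2 := hg₂.comp continuousOn_fst hm
    have c3 := hν.comp continuousOn_fst hm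
    exact continuousOn_fst.add (((((continuousOn_const).sub continuousOn_snd).mul c1.neg).add
      (continuousOn_snd.mul c2)).smul c3)
  have hcomp : IsCompact (f '' (S ×ˢ Set.Icc (0 : ℝ) 1)) :=
    (hS.prod isCompact_Icc).image_of_continuousOn hfc
  have hsub : thinShell S ν g₁ g₂ ⊆ f '' (S ×ˢ Set.Icc (0 : ℝ) 1) := by
    rintro w ⟨x, hx, t, ht1, ht2, rfl⟩
    have hpos : 0 < g₂ x + g₁ x := by linarith
    refine ⟨(x, (t + g₁ x) / (g₂ x + g₁ x)), ⟨hx, ⟨by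
      apply div_nonneg <;> linarith, by rw [div_le_one hpos]; linarith⟩⟩, ?_⟩
    have : (1 - (t + g₁ x) / (g₂ x + g₁ x)) * (-g₁ x)
        + (t + g₁ x) / (g₂ x + g₁ x) * g₂ x = t := by field_simp; ring
    simp only [f, this]
  obtain ⟨⟨x, a⟩, ⟨hx, ha0, ha1⟩, rfl⟩ := closure_minimal hsub hcomp.isClosed hz
  simp only at ha0 ha1 hx
  have := h₁ x hx
  have := h₂ x hx
  exact ⟨x, hx, _, by nlinarith, by nlinarith, rfl⟩

theorem isBounded_thinShell (hS : IsCompact S) (hT : HasTube S ν K r)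
    (h₁ : ∀ x ∈ S, g₁ x < r) (h₂ : ∀ x ∈ S, g₂ x < r) :
    Bornology.IsBounded (thinShell S ν g₁ g₂) := by
  obtain ⟨R, hR⟩ := hS.isBounded.exists_norm_le
  refine isBounded_iff_forall_norm_le.2 ⟨R + r, ?_⟩
  rintro z ⟨x, hx, t, ht1, ht2, rfl⟩
  refine (norm_add_le _ _).trans (add_le_add (hR x hx) ?_)
  rw [norm_smul, hT.norm_eq_one x hx, mul_one, Real.norm_eq_abs, abs_le]
  constructor <;> linarith [h₁ x hx, h₂ x hx]

theorem HasTube.frontier_thinShell_subset (hT : HasTube S ν K r) (hS : IsCompact S)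
    (hg₁ : ContinuousOn g₁ S) (hg₂ : ContinuousOn g₂ S) (h₁ : ∀ x ∈ S, 0 < g₁ x ∧ g₁ x < r)
    (h₂ : ∀ x ∈ S, 0 < g₂ x ∧ g₂ x < r) :
    frontier (thinShell S ν g₁ g₂)
      ⊆ (fun x => x + (-g₁ x) • ν x) '' S ∪ (fun x => x + g₂ x • ν x) '' S := by
  intro z hz
  rw [(hT.isOpen_thinShell hg₁ hg₂ (fun x hx => (h₁ x hx).2)
    fun x hx => (h₂ x hx).2).frontier_eq] at hz
  obtain ⟨x, hx, t, ht1, ht2, rfl⟩ := closure_thinShell_subset hS hT.continuousOn hg₁ hg₂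
    (fun x hx => (h₁ x hx).1) (fun x hx => (h₂ x hx).1) hz.1
  rcases ht1.eq_or_lt with h | h
  · left; exact ⟨x, hx, by simp only [h]⟩
  rcases ht2.eq_or_lt with h' | h'
  · right; exact ⟨x, hx, by simp only [h']⟩
  · exact absurd ⟨x, hx, t, h, h', rfl⟩ hz.2

theorem hasInteriorConeAt_of_mem {Ω : Set (Eucl n)} (hΩ : IsOpen Ω) {z : Eucl n} (hz : z ∈ Ω) :
    HasInteriorConeAt Ω z := by
  obtain ⟨ρ, hρ, hsub⟩ := Metric.isOpen_iff.1 hΩ z hz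
  refine ⟨0, 1, ρ / 2, one_pos, by positivity, fun p _ hpz ε _ hε => ?_⟩
  refine (Metric.ball_subset_ball' ?_).trans hsub
  simp only [smul_zero, sub_zero, one_mul]
  linarith

/-- A strictly differentiable defining function with `F' e = 1` gives an interior cone in
direction `-e`: moving by `-ε e` decreases `F` at a rate that beats its Lipschitz constant on a
ball of radius `c ε`. -/
theorem hasInteriorConeAt_of_hasStrictFDerivAt {Ω : Set (Eucl n)} {F : Eucl n → ℝ}
    {F' : Eucl n →L[ℝ] ℝ} {z e : Eucl n} (hF : HasStrictFDerivAt F F' z) (he : F' e = 1)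
    (hΩ : ∀ᶠ q in 𝓝 z, (q ∈ Ω ↔ F q < 0)) : HasInteriorConeAt Ω z := by
  set L := ‖F'‖ with hL
  have hL0 : 0 ≤ L := norm_nonneg _
  set a := ‖e‖ with ha
  have ha0 : 0 ≤ a := norm_nonneg _
  -- the linearization error is at most half of the gain on the ball of radius `c ε`
  set c : ℝ := 1 / (4 * (L + 1)) with hc
  have hc0 : 0 < c := by positivity
  have hcL : c * L ≤ 1 / 4 := by
    rw [hc, div_mul_eq_mul_div, div_le_div_iff₀ (by positivity) (by norm_num)]; linarith
  set κ : ℝ := 1 / (4 * (a + c)) with hκ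
  have hκ0 : 0 < κ := by positivity
  have hb := hF.isLittleO.bound hκ0
  obtain ⟨ρ, hρ, hρ'⟩ := Metric.eventually_nhds_iff.1 hb
  obtain ⟨ρ₁, hρ₁, hρ₁'⟩ := Metric.eventually_nhds_iff.1 hΩ
  set m := min ρ ρ₁ with hm
  have hm0 : 0 < m := lt_min hρ hρ₁
  refine ⟨e, c, min (m / 2) (m / (2 * (a + c))), hc0, by positivity,
    fun p hp hpz ε hε hε' q hq => ?_⟩
  have hqp : ‖q - (p - ε • e)‖ < c * ε := mem_ball_iff_norm.1 hq
  have e0 : q - p = (q - (p - ε • e)) - ε • e := by abel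
  have hqp' : ‖q - p‖ ≤ (a + c) * ε := by
    calc ‖q - p‖ ≤ ‖q - (p - ε • e)‖ + ‖ε • e‖ := by rw [e0]; exact norm_sub_le _ _
      _ ≤ c * ε + ε * a := by rw [norm_smul, Real.norm_of_nonneg hε.le]; gcongr
      _ = _ := by ring
  have hpz' : dist p z < m / 2 := hpz.trans_le (min_le_left _ _)
  have hqz : dist q z < m := by
    have h1 : (a + c) * ε < m / 2 := by
      have := hε'.trans_le (min_le_right _ _)
      rw [lt_div_iff₀ (by positivity)] at this
      linarith
    calc dist q z ≤ dist q p + dist p z := dist_triangle _ _ _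
      _ < m := by rw [dist_eq_norm]; linarith
  have hFp : F p < 0 := (hρ₁' ((by linarith : dist p z < m).trans_le (min_le_right _ _))).1 hp
  refine (hρ₁' (hqz.trans_le (min_le_right _ _))).2 ?_
  have hdiff := hρ' (y := (q, p)) (by
    rw [Prod.dist_eq, max_lt_iff]
    exact ⟨hqz.trans_le (min_le_left _ _), (by linarith : dist p z < m).trans_le (min_le_left _ _)⟩)
  have h2 : κ * ‖q - p‖ ≤ ε / 4 := by
    calc κ * ‖q - p‖ ≤ κ * ((a + c) * ε) := by gcongr
      _ = ε / 4 := by rw [hκ]; field_simp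
  have h3 : F' (q - p) ≤ ε / 4 - ε := by
    rw [e0, map_sub, map_smul, he, smul_eq_mul, mul_one]
    have : F' (q - (p - ε • e)) ≤ ε / 4 := by
      calc F' (q - (p - ε • e)) ≤ ‖F' (q - (p - ε • e))‖ := le_abs_self _
        _ ≤ L * ‖q - (p - ε • e)‖ := F'.le_opNorm _
        _ ≤ L * (c * ε) := by gcongr
        _ = (c * L) * ε := by ring
        _ ≤ 1 / 4 * ε := by gcongr
        _ = ε / 4 := by ring
    linarith
  have h4 := (abs_le.1 (hdiff.trans h2)).2
  simp only at h4
  linarith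

/-- Near its outer boundary the shell is `{d < g₂ ∘ π}` in normal coordinates `(π, d)`, and
`d - g₂ ∘ π` has derivative `1` in the direction `ν x`. -/
theorem HasTube.hasInteriorConeAt_top (hT : HasTube S ν K r) (hg₁ : ContinuousOn g₁ S)
    (hg₂ : IsSmoothOnSurface S g₂) (h₁ : ∀ x ∈ S, 0 < g₁ x ∧ g₁ x < r)
    (h₂ : ∀ x ∈ S, 0 < g₂ x ∧ g₂ x < r) {x : Eucl n} (hx : x ∈ S) :
    HasInteriorConeAt (thinShell S ν g₁ g₂) (x + g₂ x • ν x) := by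
  have hlt : |g₂ x| < r := by rw [abs_of_pos (h₂ x hx).1]; exact (h₂ x hx).2
  obtain ⟨π, d, π', d', hπ, hd, hπx, hdx, hπ', hd', hev⟩ := hT.coords x hx _ hlt
  obtain ⟨G, hG, hGg⟩ := hg₂ x hx
  set z := x + g₂ x • ν x with hz
  have hπc : Tendsto π (𝓝 z) (𝓝[S] x) := by
    refine tendsto_nhdsWithin_iff.2 ⟨?_, hev.mono fun p hp => hp.1⟩
    have := hπ.continuousAt.tendsto
    rwa [hπx] at this
  have hdc : Tendsto d (𝓝 z) (𝓝 (g₂ x)) := by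
    have := hd.continuousAt.tendsto
    rwa [hdx] at this
  have hGs : HasStrictFDerivAt G (fderiv ℝ G x) (π z) := by
    rw [hπx]; exact (hG.contDiffAt (x := x)).hasStrictFDerivAt (by simp)
  have hGπ : HasStrictFDerivAt (fun p => G (π p)) ((fderiv ℝ G x).comp π') z :=
    HasStrictFDerivAt.comp z (g := G) hGs hπ
  refine hasInteriorConeAt_of_hasStrictFDerivAt (e := ν x) (hd.sub hGπ) (by simp [hπ', hd']) ?_
  have hb1 := ((hg₁ x hx).tendsto.comp hπc).neg.eventually_lt hdc
    (by linarith [(h₁ x hx).1, (h₂ x hx).1])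
  have hdr := hdc.abs.eventually_lt_const hlt
  filter_upwards [hev, hb1, hdr, hπc.eventually hGg] with p hp h1 h2 h3
  have h3' : G (π p) = g₂ (π p) := h3
  change _ ↔ d p - G (π p) < 0
  rw [h3', sub_neg]
  constructor
  · rintro ⟨y, hy, t, ht1, ht2, hpy⟩
    have ht : |t| ≤ r := abs_le.2 ⟨by linarith [(h₁ y hy).2], by linarith [(h₂ y hy).2]⟩
    obtain ⟨e1, e2⟩ := hT.injective hp.1 hy h2.le ht (hp.2.trans hpy)
    rwa [e1, e2]
  · intro h4
    exact ⟨π p, hp.1, d p, h1, h4, hp.2.symm⟩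

theorem HasTube.hasInteriorConeAt (hT : HasTube S ν K r) (hS : IsCompact S)
    (hg₁ : IsSmoothOnSurface S g₁) (hg₂ : IsSmoothOnSurface S g₂)
    (h₁ : ∀ x ∈ S, 0 < g₁ x ∧ g₁ x < r) (h₂ : ∀ x ∈ S, 0 < g₂ x ∧ g₂ x < r) {z : Eucl n}
    (hz : z ∈ closure (thinShell S ν g₁ g₂)) : HasInteriorConeAt (thinShell S ν g₁ g₂) z := by
  obtain ⟨x, hx, t, ht1, ht2, rfl⟩ := closure_thinShell_subset hS hT.continuousOn
    hg₁.continuousOn hg₂.continuousOn (fun x hx => (h₁ x hx).1) (fun x hx => (h₂ x hx).1) hz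
  rcases ht1.eq_or_lt with h | h
  · -- the inner boundary is the outer boundary of the same shell for the normal field `-ν`
    have := hT.neg.hasInteriorConeAt_top hg₂.continuousOn hg₁ h₂ h₁ hx
    rw [thinShell_neg] at this
    simpa [← h] using this
  rcases ht2.eq_or_lt with h' | h'
  · rw [h']; exact hT.hasInteriorConeAt_top hg₁.continuousOn hg₂ h₁ h₂ hx
  · exact hasInteriorConeAt_of_mem (hT.isOpen_thinShell hg₁.continuousOn hg₂.continuousOn
      (fun x hx => (h₁ x hx).2) fun x hx => (h₂ x hx).2) ⟨x, hx, t, h, h', rfl⟩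

end Shell

/-! ### Surface measure under Lipschitz maps -/

section SurfaceLipschitz

variable {n : ℕ} {S : Set (Eucl n)} {ν : Eucl n → Eucl n} {K r : ℝ}

/-- A bound on the tangential gradient at `x` controls the difference quotients along `S` near
`x`, because secants of `S` near `x` are almost tangential. -/
theorem IsUnitNormalField.eventually_abs_sub_le (hν : IsUnitNormalField S ν) {g : Eucl n → ℝ}
    {x : Eucl n} (hx : x ∈ S) (hg : IsSmoothOnSurface S g) {B : ℝ} (hB : 0 < B)
    (hgB : ∀ w, HasSurfaceGradientAt S ν g x w → ‖w‖ ≤ B) :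
    ∀ᶠ p : Eucl n × Eucl n in 𝓝 (x, x), p.1 ∈ S → p.2 ∈ S →
      |g p.1 - g p.2| ≤ 2 * B * ‖p.1 - p.2‖ := by
  obtain ⟨φ, N, h⟩ := hν.exists_extension hx
  obtain ⟨G, hG, hGg⟩ := hg x hx
  have hGg' := eventually_nhdsWithin_iff.1 hGg
  set w := ∇ G x - (inner ℝ (∇ G x) (ν x)) • ν x with hw
  have hwB : ‖w‖ ≤ B := hgB w ⟨G, hG, hGg, rfl⟩
  set M := |inner ℝ (∇ G x) (ν x)| with hM
  have hM0 : 0 ≤ M := abs_nonneg _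
  have hs : HasStrictFDerivAt G (fderiv ℝ G x) x :=
    (hG.contDiffAt (x := x)).hasStrictFDerivAt (by simp)
  have hb := hs.isLittleO.bound (half_pos hB)
  -- `η` is chosen so that the normal component of the gradient contributes at most `B / 2`
  have hin := h.self_of_nhds.eventually_inner_le hx (η := B / (2 * (M + 1))) (by positivity)
  filter_upwards [hb, hin, (continuous_fst.tendsto' (x, x) x rfl).eventually hGg',
    (continuous_snd.tendsto' (x, x) x rfl).eventually hGg'] with p h1 h2 h3 h4 hp1 hp2
  have h2 := h2 hp1 hp2
  rw [h3 hp1, h4 hp2, ← inner_gradient_left, Real.norm_eq_abs] at h1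
  have e : inner ℝ (∇ G x) (p.1 - p.2) = inner ℝ w (p.1 - p.2)
      + inner ℝ (∇ G x) (ν x) * inner ℝ (p.1 - p.2) (ν x) := by
    rw [hw, inner_sub_left, inner_smul_left, real_inner_comm (p.1 - p.2) (ν x)]
    simp
  have h5 : |inner ℝ w (p.1 - p.2)| ≤ B * ‖p.1 - p.2‖ :=
    (abs_real_inner_le_norm _ _).trans (by gcongr)
  have h6 : |inner ℝ (∇ G x) (ν x) * inner ℝ (p.1 - p.2) (ν x)| ≤ B / 2 * ‖p.1 - p.2‖ := by
    rw [abs_mul]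
    calc M * |inner ℝ (p.1 - p.2) (ν x)| ≤ (M + 1) * (B / (2 * (M + 1)) * ‖p.1 - p.2‖) := by
          gcongr; linarith
      _ = B / 2 * ‖p.1 - p.2‖ := by field_simp
  rw [abs_le] at *
  constructor <;> linarith [h1.1, h1.2, h5.1, h5.2, h6.1, h6.2]

/-- The graph map of a height function of small slope is locally `2`-Lipschitz on `S`. -/
theorem HasTube.eventually_norm_sub_le (hT : HasTube S ν K r) {s : Eucl n → ℝ} {x : Eucl n}
    (hs : ∀ y ∈ S, |s y| ≤ r)
    (hlip : ∀ᶠ p : Eucl n × Eucl n in 𝓝 (x, x), p.1 ∈ S → p.2 ∈ S →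
      |s p.1 - s p.2| ≤ 3 / 4 * ‖p.1 - p.2‖) :
    ∀ᶠ p : Eucl n × Eucl n in 𝓝 (x, x), p.1 ∈ S → p.2 ∈ S →
      ‖(p.1 + s p.1 • ν p.1) - (p.2 + s p.2 • ν p.2)‖ ≤ 2 * ‖p.1 - p.2‖ := by
  filter_upwards [hlip] with p hp hp1 hp2
  have e : (p.1 + s p.1 • ν p.1) - (p.2 + s p.2 • ν p.2)
      = (p.1 - p.2) + (s p.1 - s p.2) • ν p.1 + s p.2 • (ν p.1 - ν p.2) := by
    rw [sub_smul, smul_sub]; abel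
  have h1 : ‖(s p.1 - s p.2) • ν p.1‖ ≤ 3 / 4 * ‖p.1 - p.2‖ := by
    rw [norm_smul, hT.norm_eq_one _ hp1, mul_one]; exact hp hp1 hp2
  have h2 : ‖s p.2 • (ν p.1 - ν p.2)‖ ≤ 1 / 4 * ‖p.1 - p.2‖ := by
    have := hT.r_pos
    calc ‖s p.2 • (ν p.1 - ν p.2)‖ = |s p.2| * ‖ν p.1 - ν p.2‖ := by
          rw [norm_smul, Real.norm_eq_abs]
      _ ≤ r * (K * ‖p.1 - p.2‖) := by
        gcongr
        · exact hs _ hp2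
        · exact hT.normal_sub_le _ hp1 _ hp2
      _ = (r * K) * ‖p.1 - p.2‖ := by ring
      _ ≤ _ := by gcongr; exact hT.mul_le
  rw [e]
  refine (norm_add_le _ _).trans ?_
  have := norm_add_le (p.1 - p.2) ((s p.1 - s p.2) • ν p.1)
  linarith

end SurfaceLipschitz

section HausdorffMeasure

/-- A map that shrinks distances by at most the factor `L` shrinks the `d`-dimensional Hausdorff
measure by at most `L ^ d`. -/
theorem hausdorffMeasure_le_of_dist_le {X Y : Type*} [MetricSpace X] [MeasurableSpace X]
    [BorelSpace X] [MetricSpace Y] [MeasurableSpace Y] [BorelSpace Y] {W : Set X} {Ψ : X → Y}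
    {L : NNReal} (h : ∀ p ∈ W, ∀ q ∈ W, dist p q ≤ L * dist (Ψ p) (Ψ q)) {d : ℝ} (hd : 0 ≤ d) :
    (μH[d] : Measure X) W ≤ (L : ENNReal) ^ d * (μH[d] : Measure Y) (Ψ '' W) := by
  rcases W.eq_empty_or_nonempty with rfl | ⟨w, -⟩
  · simp
  have : Nonempty X := ⟨w⟩
  have hinj : Set.InjOn Ψ W := fun p hp q hq hpq => by
    have := h p hp q hq
    rw [hpq, dist_self, mul_zero] at this
    exact dist_le_zero.1 this
  have hl : LipschitzOnWith L (Function.invFunOn Ψ W) (Ψ '' W) := by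
    refine LipschitzOnWith.of_dist_le_mul ?_
    rintro _ ⟨p, hp, rfl⟩ _ ⟨q, hq, rfl⟩
    rw [hinj.leftInvOn_invFunOn hp, hinj.leftInvOn_invFunOn hq]
    exact h p hp q hq
  have := hl.hausdorffMeasure_image_le hd
  rwa [hinj.leftInvOn_invFunOn.image_image] at this

theorem euclideanHausdorffMeasure_le_of_dist_le {X Y : Type*} [MetricSpace X] [MeasurableSpace X]
    [BorelSpace X] [MetricSpace Y] [MeasurableSpace Y] [BorelSpace Y] {W : Set X} {Ψ : X → Y}
    {L : NNReal} (h : ∀ p ∈ W, ∀ q ∈ W, dist p q ≤ L * dist (Ψ p) (Ψ q)) (d : ℕ) :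
    (μHE[d] : Measure X) W ≤ (L : ENNReal) ^ d * (μHE[d] : Measure Y) (Ψ '' W) := by
  have := hausdorffMeasure_le_of_dist_le h (d := d) (by positivity)
  rw [ENNReal.rpow_natCast] at this
  simp only [Measure.euclideanHausdorffMeasure_def, Measure.smul_apply, ENNReal.smul_def,
    smul_eq_mul]
  calc _ ≤ _ := mul_le_mul_right this _
    _ = _ := by ring

theorem LipschitzOnWith.euclideanHausdorffMeasure_image_le {X Y : Type*} [MetricSpace X]
    [MeasurableSpace X] [BorelSpace X] [MetricSpace Y] [MeasurableSpace Y] [BorelSpace Y]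
    {W : Set X} {Ψ : X → Y} {L : NNReal} (h : LipschitzOnWith L Ψ W) (d : ℕ) :
    (μHE[d] : Measure Y) (Ψ '' W) ≤ (L : ENNReal) ^ d * (μHE[d] : Measure X) W := by
  have := h.hausdorffMeasure_image_le (d := d) (by positivity)
  rw [ENNReal.rpow_natCast] at this
  simp only [Measure.euclideanHausdorffMeasure_def, Measure.smul_apply, ENNReal.smul_def,
    smul_eq_mul]
  calc _ ≤ _ := mul_le_mul_right this _
    _ = _ := by ring

theorem restrict_image_le_smul_map {X Y : Type*} [MeasurableSpace X] [MeasurableSpace Y]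
    {μ : Measure X} {μ' : Measure Y} {Φ Φ' : X → Y} {S : Set X} (hΦ' : Measurable Φ')
    (heq : Set.EqOn Φ Φ' S) {c : ENNReal}
    (h : ∀ A, MeasurableSet A → μ' (Φ '' (A ∩ S)) ≤ c * μ (A ∩ S)) :
    μ'.restrict (Φ '' S) ≤ c • (μ.restrict S).map Φ' := by
  refine Measure.le_iff.2 fun A hA => ?_
  rw [Measure.restrict_apply hA, Measure.smul_apply, Measure.map_apply hΦ' hA,
    Measure.restrict_apply (hΦ' hA), smul_eq_mul]
  refine le_trans (measure_mono ?_) (h _ (hΦ' hA))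
  rintro _ ⟨hy, x, hx, rfl⟩
  exact ⟨x, ⟨by rw [Set.mem_preimage, ← heq hx]; exact hy, hx⟩, rfl⟩

variable {n : ℕ} {S : Set (Eucl n)}

/-- If `Φ` is `L`-Lipschitz near each point of `S`, then it increases the measure by at most the
factor `L ^ d`, at whatever scale the local bound holds: measure is additive over small pieces. -/
theorem euclideanHausdorffMeasure_image_le_of_locally (hS : IsCompact S)
    {Φ : Eucl n → Eucl n} {L : NNReal}
    (h : ∀ x ∈ S, ∀ᶠ p : Eucl n × Eucl n in 𝓝 (x, x), p.1 ∈ S → p.2 ∈ S →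
      ‖Φ p.1 - Φ p.2‖ ≤ L * ‖p.1 - p.2‖) (d : ℕ) {A : Set (Eucl n)} (hA : MeasurableSet A) :
    (μHE[d] : Measure (Eucl n)) (Φ '' (A ∩ S)) ≤ (L : ENNReal) ^ d * μHE[d] (A ∩ S) := by
  have key : ∃ s', S ⊆ s' ∧ MeasurableSet s' ∧ ∀ A, MeasurableSet A →
      (μHE[d] : Measure (Eucl n)) (Φ '' (A ∩ s' ∩ S)) ≤ (L : ENNReal) ^ d * μHE[d] (A ∩ s' ∩ S) := by
    refine hS.induction_on (p := fun s => ∃ s', s ⊆ s' ∧ MeasurableSet s' ∧ ∀ A, MeasurableSet A →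
      (μHE[d] : Measure (Eucl n)) (Φ '' (A ∩ s' ∩ S)) ≤ (L : ENNReal) ^ d * μHE[d] (A ∩ s' ∩ S))
      ⟨∅, subset_rfl, MeasurableSet.empty, by simp⟩ ?_ ?_ ?_
    · rintro s t hst ⟨s', hs', h'⟩
      exact ⟨s', hst.trans hs', h'⟩
    · rintro s t ⟨s', hs', hsm, hs⟩ ⟨t', ht', htm, ht⟩
      refine ⟨s' ∪ t', Set.union_subset_union hs' ht', hsm.union htm, fun A hA => ?_⟩
      have e : A ∩ (s' ∪ t') ∩ S = (A ∩ s' ∩ S) ∪ ((A \ s') ∩ t' ∩ S) := by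
        ext y; simp only [Set.mem_inter_iff, Set.mem_union, Set.mem_sdiff]; tauto
      have hdisj : Disjoint ((A \ s') ∩ t' ∩ S) s' :=
        Set.disjoint_left.2 fun y hy hys => hy.1.1.2 hys
      have e2 : (μHE[d] : Measure (Eucl n)) (A ∩ (s' ∪ t') ∩ S)
          = μHE[d] (A ∩ s' ∩ S) + μHE[d] ((A \ s') ∩ t' ∩ S) := by
        rw [← measure_inter_add_sdiff (A ∩ (s' ∪ t') ∩ S) hsm]
        congr 2
        · ext y; simp only [Set.mem_inter_iff, Set.mem_union]; tauto
        · ext y; simp only [Set.mem_inter_iff, Set.mem_union, Set.mem_sdiff]; tauto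
      rw [e2, e, Set.image_union, mul_add]
      exact (measure_union_le _ _).trans (add_le_add (hs A hA) (ht _ (hA.diff hsm)))
    · intro x hx
      obtain ⟨ρ, hρ, hρ'⟩ := Metric.eventually_nhds_iff.1 (h x hx)
      refine ⟨_, mem_nhdsWithin_of_mem_nhds (Metric.ball_mem_nhds x hρ), Metric.ball x ρ,
        subset_rfl, measurableSet_ball, fun A hA => ?_⟩
      refine LipschitzOnWith.euclideanHausdorffMeasure_image_le
        (LipschitzOnWith.of_dist_le_mul fun y hy z hz => ?_) d
      rw [dist_eq_norm, dist_eq_norm]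
      refine hρ' (y := (y, z)) ?_ hy.2 hz.2
      rw [Prod.dist_eq, max_lt_iff]
      exact ⟨hy.1.2, hz.1.2⟩
  obtain ⟨s', hs', -, h'⟩ := key
  have := h' A hA
  rwa [Set.inter_assoc, Set.inter_eq_right.2 hs'] at this

/-- Integrals over the image of a locally Lipschitz map are bounded by integrals over `S`; only
the local Lipschitz constant `L` matters. -/
theorem setLIntegral_image_le (hS : IsCompact S) {Φ : Eucl n → Eucl n} {L : NNReal}
    (h : ∀ x ∈ S, ∀ᶠ p : Eucl n × Eucl n in 𝓝 (x, x), p.1 ∈ S → p.2 ∈ S →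
      ‖Φ p.1 - Φ p.2‖ ≤ L * ‖p.1 - p.2‖) (d : ℕ) {f : Eucl n → ENNReal} (hf : Measurable f) :
    ∫⁻ y in Φ '' S, f y ∂μHE[d] ≤ (L : ENNReal) ^ d * ∫⁻ x in S, f (Φ x) ∂μHE[d] := by
  obtain ⟨K, hK⟩ : ∃ K, LipschitzOnWith K Φ S := by
    refine LocallyLipschitzOn.exists_lipschitzOnWith_of_compact hS fun x hx => ?_
    obtain ⟨ρ, hρ, hρ'⟩ := Metric.eventually_nhds_iff.1 (h x hx)
    refine ⟨L, _, inter_mem_nhdsWithin S (Metric.ball_mem_nhds x hρ),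
      LipschitzOnWith.of_dist_le_mul fun y hy z hz => ?_⟩
    rw [dist_eq_norm, dist_eq_norm]
    refine hρ' (y := (y, z)) ?_ hy.1 hz.1
    rw [Prod.dist_eq, max_lt_iff]
    exact ⟨hy.2, hz.2⟩
  obtain ⟨Φ', hΦ', heq⟩ := hK.extend_finite_dimension
  have hm : Measurable Φ' := hΦ'.continuous.measurable
  have hle := restrict_image_le_smul_map (μ := μHE[d]) (μ' := μHE[d]) hm heq fun A hA =>
    euclideanHausdorffMeasure_image_le_of_locally hS h d hA
  calc ∫⁻ y in Φ '' S, f y ∂μHE[d]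
      ≤ ∫⁻ y, f y ∂((L : ENNReal) ^ d • ((μHE[d] : Measure (Eucl n)).restrict S).map Φ') :=
        lintegral_mono' hle le_rfl
    _ = (L : ENNReal) ^ d * ∫⁻ x in S, f (Φ' x) ∂μHE[d] := by
        rw [lintegral_smul_measure, smul_eq_mul, lintegral_map hf hm]
    _ = _ := by
        congr 1
        exact setLIntegral_congr_fun hS.measurableSet fun x hx => by rw [heq hx]

end HausdorffMeasure

/-! ### Integration over normal lines -/

section TubeIntegral

/-- If `Ψ` shrinks distances on `W` by at most the factor `L`, then the integral of `f ∘ Ψ` over `W`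
is at most a constant times the integral of `f`, and the constant depends on `L` only. Haar measures
are compared through the Hausdorff measures of top dimension. -/
theorem exists_setLIntegral_comp_le {X Y : Type*} [NormedAddCommGroup X] [NormedSpace ℝ X]
    [FiniteDimensional ℝ X] [MeasurableSpace X] [BorelSpace X] [NormedAddCommGroup Y]
    [NormedSpace ℝ Y] [FiniteDimensional ℝ Y] [MeasurableSpace Y] [BorelSpace Y]
    (hdim : Module.finrank ℝ X = Module.finrank ℝ Y) (μ : Measure X) [μ.IsAddHaarMeasure]
    (μ' : Measure Y) [μ'.IsAddHaarMeasure] (L : NNReal) :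
    ∃ C : NNReal, ∀ (W : Set X) (Ψ : X → Y), Continuous Ψ → MeasurableSet W →
      (∀ p ∈ W, ∀ q ∈ W, dist p q ≤ L * dist (Ψ p) (Ψ q)) →
      ∀ f : Y → ENNReal, Measurable f → ∫⁻ p in W, f (Ψ p) ∂μ ≤ C * ∫⁻ y, f y ∂μ' := by
  set d := Module.finrank ℝ X with hd
  have i1 : (μH[d] : Measure X).IsAddHaarMeasure := by rw [hd]; infer_instance
  have i2 : (μH[d] : Measure Y).IsAddHaarMeasure := by rw [hdim]; infer_instance
  obtain ⟨c, hc⟩ : ∃ c : NNReal, μ = c • (μH[d] : Measure X) :=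
    ⟨_, Measure.isAddLeftInvariant_eq_smul μ μH[d]⟩
  obtain ⟨c', hc'⟩ : ∃ c' : NNReal, (μH[d] : Measure Y) = c' • μ' :=
    ⟨_, Measure.isAddLeftInvariant_eq_smul μH[d] μ'⟩
  refine ⟨c * L ^ d * c', fun W Ψ hΨ hW hd' f hf => ?_⟩
  have hle : (μ.restrict W).map Ψ ≤ ((c * L ^ d * c' : NNReal) : ENNReal) • μ' := by
    refine Measure.le_iff.2 fun A hA => ?_
    rw [Measure.map_apply hΨ.measurable hA, Measure.restrict_apply (hΨ.measurable hA), hc]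
    have h1 := hausdorffMeasure_le_of_dist_le (W := Ψ ⁻¹' A ∩ W) (Ψ := Ψ) (L := L)
      (fun p hp q hq => hd' p hp.2 q hq.2) (d := (d : ℝ)) (by positivity)
    have h2 : (μH[d] : Measure Y) (Ψ '' (Ψ ⁻¹' A ∩ W)) ≤ c' * μ' A := by
      rw [hc', Measure.smul_apply, ENNReal.smul_def, smul_eq_mul]
      gcongr
      exact (Set.image_mono Set.inter_subset_left).trans (Set.image_preimage_subset _ _)
    rw [ENNReal.rpow_natCast] at h1
    rw [Measure.smul_apply, Measure.smul_apply, ENNReal.smul_def, smul_eq_mul, smul_eq_mul]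
    push_cast
    calc (c : ENNReal) * μH[d] (Ψ ⁻¹' A ∩ W) ≤ c * (L ^ d * (c' * μ' A)) := by
          gcongr; exact h1.trans (by gcongr)
      _ = _ := by ring
  calc ∫⁻ p in W, f (Ψ p) ∂μ = ∫⁻ y, f y ∂((μ.restrict W).map Ψ) :=
        (lintegral_map hf hΨ.measurable).symm
    _ ≤ ∫⁻ y, f y ∂(((c * L ^ d * c' : NNReal) : ENNReal) • μ') := lintegral_mono' hle le_rfl
    _ = _ := by rw [lintegral_smul_measure, smul_eq_mul]

variable {n : ℕ} {S : Set (Eucl n)} {ν : Eucl n → Eucl n} {K r : ℝ}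

theorem HasTube.exists_continuous_extension (hT : HasTube S ν K r) :
    ∃ ν' : Eucl n → Eucl n, Continuous ν' ∧ Set.EqOn ν ν' S := by
  have h : LipschitzOnWith ⟨K, hT.K_nonneg⟩ ν S := LipschitzOnWith.of_dist_le_mul
    fun x hx y hy => by rw [dist_eq_norm, dist_eq_norm]; exact hT.normal_sub_le x hx y hy
  obtain ⟨ν', h', he⟩ := h.extend_finite_dimension
  exact ⟨ν', h'.continuous, he⟩

/-- The orthogonal projection onto the tangent plane at `x₀` is bi-Lipschitz on `S` near `x₀`. -/
theorem HasTube.norm_sub_le_two_mul_projection (hT : HasTube S ν K r) {x₀ x y : Eucl n}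
    (hx₀ : x₀ ∈ S) (hx : x ∈ S) (hy : y ∈ S) (hxx₀ : ‖x - x₀‖ ≤ r) (hyx₀ : ‖y - x₀‖ ≤ r) :
    ‖x - y‖ ≤ 2 * ‖(ℝ ∙ ν x₀)ᗮ.orthogonalProjectionOnto (x - y)‖ := by
  have hr := hT.r_pos
  have hxy : ‖x - y‖ ≤ 8 * r := by
    have := norm_sub_le (x - x₀) (y - x₀)
    rw [sub_sub_sub_cancel_right] at this
    linarith
  have h1 : |inner ℝ (ν x₀) (x - y)| ≤ 1 / 2 * ‖x - y‖ := by
    have e : inner ℝ (ν x₀) (x - y) = inner ℝ (x - y) (ν x) - inner ℝ (x - y) (ν x - ν x₀) := by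
      rw [inner_sub_right (x - y), sub_sub_cancel, real_inner_comm]
    have h2 : |inner ℝ (x - y) (ν x - ν x₀)| ≤ ‖x - y‖ * (1 / 4) := by
      refine (abs_real_inner_le_norm _ _).trans ?_
      gcongr
      calc ‖ν x - ν x₀‖ ≤ K * ‖x - x₀‖ := hT.normal_sub_le x hx x₀ hx₀
        _ ≤ K * r := by have := hT.K_nonneg; gcongr
        _ ≤ 1 / 4 := by rw [mul_comm]; exact hT.mul_le
    have h3 := hT.inner_le x hx y hy hxy
    rw [e]
    exact (abs_sub _ _).trans (by linarith)
  have h2 : ‖x - y‖ ≤ |inner ℝ (ν x₀) (x - y)|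
      + ‖(ℝ ∙ ν x₀)ᗮ.orthogonalProjectionOnto (x - y)‖ := by
    have e := (ℝ ∙ ν x₀).starProjection_add_starProjection_orthogonal (x - y)
    rw [Submodule.starProjection_unit_singleton ℝ (hT.norm_eq_one x₀ hx₀)] at e
    calc ‖x - y‖ ≤ ‖(inner ℝ (ν x₀) (x - y)) • ν x₀‖ + ‖(ℝ ∙ ν x₀)ᗮ.starProjection (x - y)‖ := by
          conv_lhs => rw [← e]
          exact norm_add_le _ _
      _ = _ := by rw [norm_smul, hT.norm_eq_one x₀ hx₀, mul_one, Real.norm_eq_abs]; rfl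
  linarith

/-- Integration over the normal lines through a small piece of `S` is controlled by Lebesgue
measure. The piece is a Lipschitz graph over a compact subset of the tangent plane, and the normal
map is bi-Lipschitz on the product of that subset with `(-r, r)`. -/
theorem HasTube.exists_local_tube_bound (hT : HasTube S ν K r) (hS : IsCompact S) {x₀ : Eucl n}
    (hx₀ : x₀ ∈ S) {ν' : Eucl n → Eucl n} (hν' : Continuous ν') (heq : Set.EqOn ν ν' S) :
    ∃ C : NNReal, ∀ f : Eucl n → ENNReal, Measurable f →
      ∫⁻ x in S ∩ Metric.closedBall x₀ r, (∫⁻ t in Set.Ioo (-r) r, f (x + t • ν' x)) ∂μHE[n - 1]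
        ≤ C * ∫⁻ z, f z := by
  have hr := hT.r_pos
  have hν₀ : ν x₀ ≠ 0 := norm_ne_zero_iff.1 (by rw [hT.norm_eq_one x₀ hx₀]; exact one_ne_zero)
  obtain ⟨m, rfl⟩ : ∃ m, n = m + 1 := by
    cases n with
    | zero => exact absurd (Subsingleton.elim _ _) hν₀
    | succ m => exact ⟨m, rfl⟩
  rw [Nat.add_sub_cancel]
  set F := (ℝ ∙ ν x₀)ᗮ with hF
  have hdim : Module.finrank ℝ F = m := by
    have : Fact (Module.finrank ℝ (Eucl (m + 1)) = m + 1) := ⟨by simp⟩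
    exact Submodule.finrank_orthogonal_span_singleton hν₀
  have iF : (μHE[m] : Measure F).IsAddHaarMeasure := by
    have := isAddHaarMeasure_euclideanHausdorffMeasure (E := F)
    rwa [hdim] at this
  set P := F.orthogonalProjectionOnto with hP
  set B := S ∩ Metric.closedBall x₀ r with hB
  have hBc : IsCompact B := hS.inter_right Metric.isClosed_closedBall
  have hanti : ∀ x ∈ B, ∀ y ∈ B, dist x y ≤ (2 : NNReal) * dist (P x) (P y) := fun x hx y hy => by
    rw [dist_eq_norm, dist_eq_norm, ← map_sub]
    exact hT.norm_sub_le_two_mul_projection hx₀ hx.1 hy.1 (mem_closedBall_iff_norm.1 hx.2)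
      (mem_closedBall_iff_norm.1 hy.2)
  have hinj : Set.InjOn P B := fun x hx y hy hxy => by
    have := hanti x hx y hy
    rw [hxy, dist_self, mul_zero] at this
    exact dist_le_zero.1 this
  set U := P '' B with hU
  have hUc : IsCompact U := hBc.image P.continuous
  have hlip : LipschitzOnWith 2 (Function.invFunOn P B) U := by
    refine LipschitzOnWith.of_dist_le_mul ?_
    rintro _ ⟨p, hp, rfl⟩ _ ⟨q, hq, rfl⟩
    rw [hinj.leftInvOn_invFunOn hp, hinj.leftInvOn_invFunOn hq]
    exact hanti p hp q hq
  -- `γ` parametrizes the piece of `S` by its projection; it is extended only for measurability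
  obtain ⟨γ, hγ, hγe⟩ := hlip.extend_finite_dimension
  have hγc : Continuous γ := hγ.continuous
  have hγP : ∀ x ∈ B, γ (P x) = x := fun x hx => by
    rw [← hγe (Set.mem_image_of_mem P hx), hinj.leftInvOn_invFunOn hx]
  have hmeas : ∀ A : Set (Eucl (m + 1)), (μHE[m] : Measure (Eucl (m + 1))) (A ∩ B)
      ≤ (2 : NNReal) ^ m * (μHE[m] : Measure F) (U ∩ γ ⁻¹' A) := fun A => by
    refine (euclideanHausdorffMeasure_le_of_dist_le
      (fun p hp q hq => hanti p hp.2 q hq.2) m).trans ?_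
    gcongr
    rintro _ ⟨x, hx, rfl⟩
    exact ⟨Set.mem_image_of_mem P hx.2, by rw [Set.mem_preimage, hγP x hx.2]; exact hx.1⟩
  obtain ⟨C, hC⟩ := exists_setLIntegral_comp_le (X := F × ℝ) (Y := Eucl (m + 1))
    (by simp [hdim]) ((μHE[m] : Measure F).prod volume) volume 2
  refine ⟨2 ^ m * C, fun f hf => ?_⟩
  have hle : (μHE[m] : Measure (Eucl (m + 1))).restrict B
      ≤ ((2 : NNReal) : ENNReal) ^ m • ((μHE[m] : Measure F).restrict U).map γ := by
    refine Measure.le_iff.2 fun A hA => ?_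
    rw [Measure.restrict_apply hA, Measure.smul_apply, Measure.map_apply hγc.measurable hA,
      Measure.restrict_apply (hγc.measurable hA), smul_eq_mul, Set.inter_comm (γ ⁻¹' A)]
    exact hmeas A
  set Ψ : F × ℝ → Eucl (m + 1) := fun q => γ q.1 + q.2 • ν' (γ q.1) with hΨ
  have hΨc : Continuous Ψ := by fun_prop
  have hWm : MeasurableSet (U ×ˢ Set.Ioo (-r) r) := hUc.measurableSet.prod measurableSet_Ioo
  have hΨd : ∀ p ∈ U ×ˢ Set.Ioo (-r) r, ∀ q ∈ U ×ˢ Set.Ioo (-r) r,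
      dist p q ≤ (2 : NNReal) * dist (Ψ p) (Ψ q) := by
    rintro ⟨_, t⟩ ⟨⟨x, hx, rfl⟩, ht⟩ ⟨_, s⟩ ⟨⟨y, hy, rfl⟩, hs⟩
    have hx1 := mem_closedBall_iff_norm.1 hx.2
    have hy1 := mem_closedBall_iff_norm.1 hy.2
    have hxy : ‖x - y‖ ≤ 8 * r := by
      have := norm_sub_le (x - x₀) (y - x₀)
      rw [sub_sub_sub_cancel_right] at this
      linarith
    have hs' : |s| ≤ r := (abs_lt.2 hs).le
    have key := hT.norm_sub_le_two_mul hx.1 hy.1 hxy (t := t) hs'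
    simp only [hΨ, hγP x hx, hγP y hy, ← heq hx.1, ← heq hy.1]
    rw [Prod.dist_eq, dist_eq_norm (x + t • ν x)]
    refine max_le ?_ key.2
    rw [dist_eq_norm, ← map_sub]
    exact (Submodule.norm_orthogonalProjectionOnto_apply_le F (x - y)).trans key.1
  have hk : Measurable fun x : Eucl (m + 1) => ∫⁻ t : ℝ in Set.Ioo (-r) r, f (x + t • ν' x) :=
    Measurable.lintegral_prod_right' (f := fun q : Eucl (m + 1) × ℝ => f (q.1 + q.2 • ν' q.1))
      (hf.comp (by fun_prop))
  calc ∫⁻ x in B, (∫⁻ t in Set.Ioo (-r) r, f (x + t • ν' x)) ∂μHE[m]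
      ≤ ∫⁻ x, (∫⁻ t in Set.Ioo (-r) r, f (x + t • ν' x))
           ∂(((2 : NNReal) : ENNReal) ^ m • ((μHE[m] : Measure F).restrict U).map γ) :=
        lintegral_mono' hle le_rfl
    _ = ((2 : NNReal) : ENNReal) ^ m * ∫⁻ y in U, (∫⁻ t in Set.Ioo (-r) r, f (Ψ (y, t))) ∂μHE[m] := by
        rw [lintegral_smul_measure, smul_eq_mul, lintegral_map hk hγc.measurable]
    _ = ((2 : NNReal) : ENNReal) ^ m
          * ∫⁻ q in U ×ˢ Set.Ioo (-r) r, f (Ψ q) ∂((μHE[m] : Measure F).prod volume) := by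
        rw [setLIntegral_prod (fun q => f (Ψ q)) (hf.comp hΨc.measurable).aemeasurable]
    _ ≤ ((2 : NNReal) : ENNReal) ^ m * (C * ∫⁻ z, f z) := by
        gcongr; exact hC _ Ψ hΨc hWm hΨd f hf
    _ = _ := by push_cast; ring

/-- Integration over all normal lines of `S` up to height `r`, with the surface measure on `S`, is
controlled by Lebesgue measure. -/
theorem HasTube.exists_tube_bound (hT : HasTube S ν K r) (hS : IsCompact S) :
    ∃ C : NNReal, ∀ f : Eucl n → ENNReal, Measurable f →
      ∫⁻ x in S, (∫⁻ t in Set.Ioo (-r) r, f (x + t • ν x)) ∂μHE[n - 1] ≤ C * ∫⁻ z, f z := by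
  obtain ⟨ν', hν', heq⟩ := hT.exists_continuous_extension
  obtain ⟨t, ht, hcov⟩ := hS.elim_nhds_subcover (fun x => Metric.closedBall x r)
    fun x _ => Metric.closedBall_mem_nhds x hT.r_pos
  have hcov' : S ⊆ ⋃ x ∈ t, S ∩ Metric.closedBall x r := by
    rw [← Set.inter_iUnion₂]; exact Set.subset_inter subset_rfl hcov
  choose! C hC using fun x hx => hT.exists_local_tube_bound hS (x₀ := x) hx hν' heq
  refine ⟨∑ x ∈ t, C x, fun f hf => ?_⟩
  calc ∫⁻ x in S, (∫⁻ t in Set.Ioo (-r) r, f (x + t • ν x)) ∂μHE[n - 1]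
      = ∫⁻ x in S, (∫⁻ t in Set.Ioo (-r) r, f (x + t • ν' x)) ∂μHE[n - 1] :=
        setLIntegral_congr_fun hS.measurableSet fun x hx => by simp only [heq hx]
    _ ≤ ∫⁻ x in ⋃ y : t, S ∩ Metric.closedBall (y : Eucl n) r,
          (∫⁻ t in Set.Ioo (-r) r, f (x + t • ν' x)) ∂μHE[n - 1] :=
        lintegral_mono_set (by rwa [Set.iUnion_subtype])
    _ ≤ ∑ y ∈ t, ∫⁻ x in S ∩ Metric.closedBall y r,
          (∫⁻ t in Set.Ioo (-r) r, f (x + t • ν' x)) ∂μHE[n - 1] := by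
        refine (lintegral_iUnion_le _ _).trans (le_of_eq ?_)
        rw [tsum_fintype]
        exact Finset.sum_coe_sort t fun y => ∫⁻ x in S ∩ Metric.closedBall y r,
          (∫⁻ t in Set.Ioo (-r) r, f (x + t • ν' x)) ∂μHE[n - 1]
    _ ≤ ∑ y ∈ t, C y * ∫⁻ z, f z := Finset.sum_le_sum fun y hy => hC y (ht y hy) f hf
    _ = _ := by push_cast; rw [Finset.sum_mul]

end TubeIntegral

/-! ### The trace inequality for smooth functions on normal lines -/

section TraceInequality

/-- The one-dimensional trace inequality: `φ(s)² - φ(t)² = ∫ 2 φ φ'` is averaged over `t`, and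
`2 |φ φ'| ≤ φ² / ℓ + ℓ φ'²` with `ℓ = b - a`. -/
theorem sq_le_integral_of_hasDerivAt {φ φ' : ℝ → ℝ} (hφ : ∀ t, HasDerivAt φ (φ' t) t)
    (hφ' : Continuous φ') {a b s : ℝ} (hab : a < b) (hs : s ∈ Set.Icc a b) :
    φ s ^ 2 ≤ ∫ t in Set.Ioc a b, (2 / (b - a) * φ t ^ 2 + (b - a) * φ' t ^ 2) := by
  set l := b - a with hl
  have hl0 : 0 < l := sub_pos.2 hab
  have hφc : Continuous φ := continuous_iff_continuousAt.2 fun t => (hφ t).continuousAt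
  set J := ∫ t in Set.Ioc a b, (1 / l * φ t ^ 2 + l * φ' t ^ 2) with hJ
  have hint : ∀ {f : ℝ → ℝ}, Continuous f → IntegrableOn f (Set.Ioc a b) := fun hf =>
    (hf.integrableOn_Icc).mono_set Set.Ioc_subset_Icc_self
  have key : ∀ t ∈ Set.Ioc a b, φ s ^ 2 ≤ φ t ^ 2 + J := by
    intro t ht
    have h1 : ∫ y in t..s, 2 * φ y * φ' y = φ s ^ 2 - φ t ^ 2 := by
      refine intervalIntegral.integral_eq_sub_of_hasDerivAt (f := fun y => φ y ^ 2)
        (fun y _ => ?_) ((by fun_prop : Continuous fun y => 2 * φ y * φ' y).intervalIntegrable _ _)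
      have := (hφ y).fun_pow 2
      simpa using this
    have h2 : ‖∫ y in t..s, 2 * φ y * φ' y‖ ≤ J := by
      refine intervalIntegral.norm_integral_le_integral_norm_uIoc.trans ?_
      have hsub : Set.uIoc t s ⊆ Set.Ioc a b := by
        rw [Set.uIoc]
        exact Set.Ioc_subset_Ioc (le_min ht.1.le hs.1) (max_le ht.2 hs.2)
      have hc : Continuous fun y => ‖2 * φ y * φ' y‖ := by fun_prop
      refine (setIntegral_mono_set (hint hc) (ae_of_all _ fun y => norm_nonneg _)
        hsub.eventuallyLE).trans ?_
      refine setIntegral_mono (hint hc) (hint (by fun_prop)) fun y => ?_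
      simp only [Real.norm_eq_abs]
      rw [abs_le]
      have e : 1 / l * φ y ^ 2 + l * φ' y ^ 2 - 2 * φ y * φ' y
          = 1 / l * (φ y - l * φ' y) ^ 2 := by field_simp; ring
      have e' : 1 / l * φ y ^ 2 + l * φ' y ^ 2 + 2 * φ y * φ' y
          = 1 / l * (φ y + l * φ' y) ^ 2 := by field_simp; ring
      have p : 0 ≤ 1 / l * (φ y - l * φ' y) ^ 2 := by positivity
      have p' : 0 ≤ 1 / l * (φ y + l * φ' y) ^ 2 := by positivity
      constructor <;> linarith
    rw [h1] at h2
    have := (le_abs_self _).trans h2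
    linarith
  have hvol : volume.real (Set.Ioc a b) = l := by
    rw [measureReal_def, Real.volume_Ioc, ENNReal.toReal_ofReal hl0.le]
  have h3 : l * φ s ^ 2 ≤ (∫ t in Set.Ioc a b, φ t ^ 2) + l * J := by
    have := setIntegral_mono_on (μ := volume) (hint continuous_const)
      (hint (by fun_prop : Continuous fun t => φ t ^ 2 + J)) measurableSet_Ioc key
    rwa [integral_add (hint (by fun_prop)) (hint continuous_const), setIntegral_const,
      setIntegral_const, hvol, smul_eq_mul, smul_eq_mul] at this
  have h4 : ∫ t in Set.Ioc a b, (2 / l * φ t ^ 2 + l * φ' t ^ 2)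
      = 1 / l * (∫ t in Set.Ioc a b, φ t ^ 2) + J := by
    rw [hJ, ← integral_const_mul, ← integral_add (hint (by fun_prop)) (hint (by fun_prop))]
    congr 1; ext t; ring
  rw [h4]
  refine le_of_mul_le_mul_left (h3.trans (le_of_eq ?_)) hl0
  field_simp

theorem enorm_sq_le_lintegral_of_hasDerivAt {φ φ' : ℝ → ℝ} (hφ : ∀ t, HasDerivAt φ (φ' t) t)
    (hφ' : Continuous φ') {a b s : ℝ} (hab : a < b) (hs : s ∈ Set.Icc a b) :
    ‖φ s‖ₑ ^ 2 ≤ ∫⁻ t in Set.Ioo a b,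
      (ENNReal.ofReal (2 / (b - a)) * ‖φ t‖ₑ ^ 2 + ENNReal.ofReal (b - a) * ‖φ' t‖ₑ ^ 2) := by
  have hl0 : 0 < b - a := sub_pos.2 hab
  have hφc : Continuous φ := continuous_iff_continuousAt.2 fun t => (hφ t).continuousAt
  have hsq : ∀ y : ℝ, ‖y‖ₑ ^ 2 = ENNReal.ofReal (y ^ 2) := fun y => by
    rw [← sq_abs, ENNReal.ofReal_pow (abs_nonneg _), Real.enorm_eq_ofReal_abs]
  have hc : Continuous fun t => 2 / (b - a) * φ t ^ 2 + (b - a) * φ' t ^ 2 := by fun_prop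
  rw [hsq]
  refine (ENNReal.ofReal_le_ofReal (sq_le_integral_of_hasDerivAt hφ hφ' hab hs)).trans
    (le_of_eq ?_)
  rw [ofReal_integral_eq_lintegral_ofReal
    ((hc.integrableOn_Icc).mono_set Set.Ioc_subset_Icc_self) (ae_of_all _ fun t => by positivity),
    ← restrict_Ioo_eq_restrict_Ioc]
  refine lintegral_congr fun t => ?_
  rw [ENNReal.ofReal_add (by positivity) (by positivity), ENNReal.ofReal_mul (by positivity),
    ENNReal.ofReal_mul hl0.le, hsq, hsq]

variable {n : ℕ} {S : Set (Eucl n)} {ν : Eucl n → Eucl n} {K r : ℝ} {g₁ g₂ : Eucl n → ℝ}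

/-- The trace inequality on each normal line, integrated over `S`: values of `v` at height `s`
inside the shell are controlled by the energy of `v` in the shell. -/
theorem HasTube.setLIntegral_graph_le (hT : HasTube S ν K r) (hS : IsCompact S)
    (hg₁ : ContinuousOn g₁ S) (hg₂ : ContinuousOn g₂ S) {α β : ℝ} (hα : 0 < α)
    (h₁ : ∀ x ∈ S, α ≤ g₁ x ∧ g₁ x ≤ β) (h₂ : ∀ x ∈ S, α ≤ g₂ x ∧ g₂ x ≤ β) (hβ : β < r)
    {C : NNReal} (hC : ∀ f : Eucl n → ENNReal, Measurable f →
      ∫⁻ x in S, (∫⁻ t in Set.Ioo (-r) r, f (x + t • ν x)) ∂μHE[n - 1] ≤ C * ∫⁻ z, f z)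
    {v : Eucl n → ℝ} (hv : ContDiff ℝ ∞ v) {s : Eucl n → ℝ}
    (hs : ∀ x ∈ S, s x ∈ Set.Icc (-g₁ x) (g₂ x)) :
    ∫⁻ x in S, ‖v (x + s x • ν x)‖ₑ ^ 2 ∂μHE[n - 1] ≤
      C * (ENNReal.ofReal (1 / α) * eLpNorm v 2 (volume.restrict (thinShell S ν g₁ g₂)) ^ 2
        + ENNReal.ofReal (2 * β) * eLpNorm (∇ v) 2 (volume.restrict (thinShell S ν g₁ g₂)) ^ 2) := by
  set Ω := thinShell S ν g₁ g₂ with hΩdef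
  have hΩ : MeasurableSet Ω := (hT.isOpen_thinShell hg₁ hg₂ (fun x hx => (h₁ x hx).2.trans_lt hβ)
    fun x hx => (h₂ x hx).2.trans_lt hβ).measurableSet
  have hgc : Continuous (∇ v) := hv.continuous_gradient
  set e : Eucl n → ENNReal := fun z =>
    ENNReal.ofReal (1 / α) * ‖v z‖ₑ ^ 2 + ENNReal.ofReal (2 * β) * ‖∇ v z‖ₑ ^ 2 with he
  have hm1 : Measurable fun z => ‖v z‖ₑ ^ 2 := (hv.continuous.measurable.enorm).pow_const 2
  have hm2 : Measurable fun z => ‖∇ v z‖ₑ ^ 2 := (hgc.measurable.enorm).pow_const 2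
  have hem : Measurable e := (hm1.const_mul _).add (hm2.const_mul _)
  have hpt : ∀ x ∈ S, ‖v (x + s x • ν x)‖ₑ ^ 2
      ≤ ∫⁻ t in Set.Ioo (-r) r, Ω.indicator e (x + t • ν x) := by
    intro x hx
    obtain ⟨a1, a2⟩ := h₁ x hx
    obtain ⟨b1, b2⟩ := h₂ x hx
    have hd : ∀ t : ℝ, HasDerivAt (fun t : ℝ => v (x + t • ν x))
        (inner ℝ (∇ v (x + t • ν x)) (ν x)) t := fun t => by
      have h0 : HasDerivAt (fun t : ℝ => x + t • ν x) (ν x) t := by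
        simpa using ((hasDerivAt_id t).smul_const (ν x)).const_add x
      have := (hv.hasGradientAt (x + t • ν x)).hasFDerivAt.comp_hasDerivAt t h0
      simpa [Function.comp_def] using this
    have hdc : Continuous fun t : ℝ => inner ℝ (∇ v (x + t • ν x)) (ν x) := by fun_prop
    have hab : -g₁ x < g₂ x := by linarith
    refine (enorm_sq_le_lintegral_of_hasDerivAt hd hdc hab (hs x hx)).trans ?_
    calc _ ≤ ∫⁻ t in Set.Ioo (-g₁ x) (g₂ x), Ω.indicator e (x + t • ν x) := by
          refine setLIntegral_mono' measurableSet_Ioo fun t ht => ?_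
          rw [Set.indicator_of_mem (show x + t • ν x ∈ Ω from ⟨x, hx, t, ht.1, ht.2, rfl⟩)]
          refine add_le_add ?_ ?_
          · gcongr ?_ * _
            apply ENNReal.ofReal_le_ofReal
            rw [div_le_div_iff₀ (by linarith) hα]
            linarith
          · gcongr ?_ * ?_ ^ 2
            · apply ENNReal.ofReal_le_ofReal
              linarith
            · rw [← ofReal_norm, ← ofReal_norm]
              apply ENNReal.ofReal_le_ofReal
              refine (norm_inner_le_norm _ _).trans (le_of_eq ?_)
              rw [hT.norm_eq_one x hx, mul_one]
      _ ≤ _ := lintegral_mono_set (Set.Ioo_subset_Ioo (by linarith) (by linarith))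
  calc ∫⁻ x in S, ‖v (x + s x • ν x)‖ₑ ^ 2 ∂μHE[n - 1]
      ≤ ∫⁻ x in S, (∫⁻ t in Set.Ioo (-r) r, Ω.indicator e (x + t • ν x)) ∂μHE[n - 1] :=
        setLIntegral_mono' hS.measurableSet hpt
    _ ≤ C * ∫⁻ z, Ω.indicator e z := hC _ (hem.indicator hΩ)
    _ = _ := by
      rw [lintegral_indicator hΩ, eLpNorm_two_sq, eLpNorm_two_sq, he,
        lintegral_add_left (hm1.const_mul _), lintegral_const_mul _ hm1, lintegral_const_mul _ hm2]

end TraceInequality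

/-! ### Traces of Sobolev functions by density -/

section TraceExistence

variable {n : ℕ} {Ω T : Set (Eucl n)} {u : Eucl n → ℝ} {G : Eucl n → Eucl n}

theorem gradient_sub_of_contDiff {v w : Eucl n → ℝ} (hv : ContDiff ℝ ∞ v) (hw : ContDiff ℝ ∞ w) :
    ∇ (v - w) = ∇ v - ∇ w := by
  ext1 p
  refine HasGradientAt.gradient ?_
  rw [hasGradientAt_iff_hasFDerivAt, Pi.sub_apply, map_sub]
  exact (hv.hasGradientAt p).hasFDerivAt.sub (hw.hasGradientAt p).hasFDerivAt

theorem Continuous.memLp_restrict_of_isBounded {F : Type*} [NormedAddCommGroup F]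
    [SecondCountableTopology F] {f : Eucl n → F} (hf : Continuous f)
    (hΩ : Bornology.IsBounded Ω) : MemLp f 2 (volume.restrict Ω) := by
  obtain ⟨M, hM⟩ := hΩ.isCompact_closure.exists_bound_of_continuousOn hf.continuousOn
  have : IsFiniteMeasure (volume.restrict (closure Ω)) :=
    ⟨by rw [Measure.restrict_apply_univ]; exact hΩ.isCompact_closure.measure_lt_top⟩
  have h : MemLp f 2 (volume.restrict (closure Ω)) := by
    refine MemLp.of_bound hf.aestronglyMeasurable M ?_
    filter_upwards [ae_restrict_mem isClosed_closure.measurableSet] with x hx using hM x hx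
  exact h.mono_measure (Measure.restrict_mono subset_closure le_rfl)

theorem eLpNorm_sub_le_add {α F : Type*} [MeasurableSpace α] [NormedAddCommGroup F]
    {μ : Measure α} {a b c : α → F} (ha : AEStronglyMeasurable a μ)
    (hb : AEStronglyMeasurable b μ) (hc : AEStronglyMeasurable c μ) :
    eLpNorm (a - b) 2 μ ≤ eLpNorm (a - c) 2 μ + eLpNorm (b - c) 2 μ := by
  have e : a - b = (a - c) - (b - c) := by abel
  rw [e]
  exact eLpNorm_sub_le (ha.sub hc) (hb.sub hc) (by norm_num)

theorem eLpNorm_le_sub_add {α F : Type*} [MeasurableSpace α] [NormedAddCommGroup F]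
    {μ : Measure α} {a c : α → F} (ha : AEStronglyMeasurable a μ)
    (hc : AEStronglyMeasurable c μ) :
    eLpNorm a 2 μ ≤ eLpNorm (a - c) 2 μ + eLpNorm c 2 μ := by
  conv_lhs => rw [← sub_add_cancel a c]
  exact eLpNorm_add_le (ha.sub hc) hc (by norm_num)

/-- A trace inequality for smooth functions extends to all traces by continuity. -/
theorem IsSobolevTrace.eLpNorm_le (hu : IsSobolevW12 Ω u G) {p q : ENNReal} (hp : p ≠ ⊤)
    (hq : q ≠ ⊤) (hineq : ∀ v : Eucl n → ℝ, ContDiff ℝ ∞ v → eLpNorm v 2 (surfaceMeasure T) ≤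
      p * eLpNorm v 2 (volume.restrict Ω) + q * eLpNorm (∇ v) 2 (volume.restrict Ω))
    {w : Eucl n → ℝ} (hw : IsSobolevTrace Ω T u G w) :
    eLpNorm w 2 (surfaceMeasure T) ≤
      p * eLpNorm u 2 (volume.restrict Ω) + q * eLpNorm G 2 (volume.restrict Ω) := by
  obtain ⟨hwL, v, hv, hvu, hvG, hvw⟩ := hw
  have hlim : Tendsto (fun k => eLpNorm (v k - w) 2 (surfaceMeasure T)
      + (p * (eLpNorm (v k - u) 2 (volume.restrict Ω) + eLpNorm u 2 (volume.restrict Ω))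
      + q * (eLpNorm (∇ (v k) - G) 2 (volume.restrict Ω) + eLpNorm G 2 (volume.restrict Ω))))
      atTop (𝓝 (0 + (p * (0 + eLpNorm u 2 (volume.restrict Ω))
        + q * (0 + eLpNorm G 2 (volume.restrict Ω))))) :=
    hvw.add ((ENNReal.Tendsto.const_mul (hvu.add_const _) (Or.inr hp)).add
      (ENNReal.Tendsto.const_mul (hvG.add_const _) (Or.inr hq)))
  simp only [zero_add] at hlim
  refine ge_of_tendsto' hlim fun k => ?_
  have hvm : AEStronglyMeasurable (v k) (surfaceMeasure T) :=
    (hv k).continuous.aestronglyMeasurable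
  calc eLpNorm w 2 (surfaceMeasure T)
      ≤ eLpNorm (w - v k) 2 (surfaceMeasure T) + eLpNorm (v k) 2 (surfaceMeasure T) :=
        eLpNorm_le_sub_add hwL.1 hvm
    _ ≤ _ := by
      rw [eLpNorm_sub_comm]
      gcongr
      refine (hineq _ (hv k)).trans ?_
      gcongr
      · exact eLpNorm_le_sub_add (hv k).continuous.aestronglyMeasurable hu.memLp.1
      · exact eLpNorm_le_sub_add (hv k).continuous_gradient.aestronglyMeasurable hu.memLp_grad.1

/-- Smooth approximations in `W^{1,2}(Ω)` are Cauchy in `L²(T)` by the trace inequality, so their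
limit is a trace. -/
theorem IsSobolevW12.exists_isSobolevTrace (hu : IsSobolevW12 Ω u G)
    (hb : Bornology.IsBounded Ω) {p q : ENNReal} (hp : p ≠ ⊤)
    (hq : q ≠ ⊤) (hineq : ∀ v : Eucl n → ℝ, ContDiff ℝ ∞ v → eLpNorm v 2 (surfaceMeasure T) ≤
      p * eLpNorm v 2 (volume.restrict Ω) + q * eLpNorm (∇ v) 2 (volume.restrict Ω))
    (happrox : ∃ v : ℕ → Eucl n → ℝ, (∀ k, ContDiff ℝ ∞ (v k)) ∧
      Tendsto (fun k => eLpNorm (v k - u) 2 (volume.restrict Ω)) atTop (𝓝 0) ∧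
      Tendsto (fun k => eLpNorm (∇ (v k) - G) 2 (volume.restrict Ω)) atTop (𝓝 0)) :
    ∃ w, IsSobolevTrace Ω T u G w := by
  obtain ⟨v, hv, hvu, hvG⟩ := happrox
  have hvT : ∀ k, MemLp (v k) 2 (surfaceMeasure T) := fun k =>
    ⟨(hv k).continuous.aestronglyMeasurable, (hineq _ (hv k)).trans_lt (ENNReal.add_lt_top.2
      ⟨ENNReal.mul_lt_top hp.lt_top ((hv k).continuous.memLp_restrict_of_isBounded hb).2,
        ENNReal.mul_lt_top hq.lt_top
          ((hv k).continuous_gradient.memLp_restrict_of_isBounded hb).2⟩)⟩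
  have : Fact ((1 : ENNReal) ≤ 2) := ⟨by norm_num⟩
  have hcau : CauchySeq fun k => (hvT k).toLp := by
    rw [Lp.cauchySeq_Lp_iff_cauchySeq_eLpNorm]
    have hfst : Tendsto (Prod.fst : ℕ × ℕ → ℕ) atTop atTop := by
      rw [← prod_atTop_atTop_eq]; exact tendsto_fst
    have hsnd : Tendsto (Prod.snd : ℕ × ℕ → ℕ) atTop atTop := by
      rw [← prod_atTop_atTop_eq]; exact tendsto_snd
    have hlim := (ENNReal.Tendsto.const_mul ((hvu.comp hfst).add (hvu.comp hsnd))
      (Or.inr hp)).add (ENNReal.Tendsto.const_mul ((hvG.comp hfst).add (hvG.comp hsnd))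
      (Or.inr hq))
    simp only [add_zero, mul_zero] at hlim
    refine tendsto_of_tendsto_of_tendsto_of_le_of_le tendsto_const_nhds hlim (fun _ => zero_le)
      fun kl => ?_
    have e : eLpNorm ((hvT kl.1).toLp - (hvT kl.2).toLp : Eucl n → ℝ) 2 (surfaceMeasure T)
        = eLpNorm (v kl.1 - v kl.2) 2 (surfaceMeasure T) :=
      eLpNorm_congr_ae ((hvT kl.1).coeFn_toLp.sub (hvT kl.2).coeFn_toLp)
    dsimp only
    rw [e]
    refine (hineq (v kl.1 - v kl.2) ((hv kl.1).sub (hv kl.2))).trans ?_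
    rw [gradient_sub_of_contDiff (hv _) (hv _)]
    exact add_le_add
      (mul_le_mul_right (eLpNorm_sub_le_add (hv _).continuous.aestronglyMeasurable
        (hv _).continuous.aestronglyMeasurable hu.memLp.1) _)
      (mul_le_mul_right (eLpNorm_sub_le_add (hv _).continuous_gradient.aestronglyMeasurable
        (hv _).continuous_gradient.aestronglyMeasurable hu.memLp_grad.1) _)
  obtain ⟨w, hw⟩ := cauchySeq_tendsto_of_complete hcau
  rw [Lp.tendsto_Lp_iff_tendsto_eLpNorm'] at hw
  refine ⟨w, Lp.memLp w, v, hv, hvu, hvG, hw.congr fun k => eLpNorm_congr_ae ?_⟩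
  exact (hvT k).coeFn_toLp.sub (ae_eq_refl _)

end TraceExistence

/-! ### The trace inequality on the surface and on the boundary of the shell -/

section Assembly

theorem ENNReal.le_mul_add_mul_of_sq_le {x p q a b : ENNReal}
    (h : x ^ 2 ≤ p ^ 2 * a ^ 2 + q ^ 2 * b ^ 2) : x ≤ p * a + q * b := by
  rw [← ENNReal.pow_le_pow_left_iff two_ne_zero]
  refine h.trans ?_
  calc p ^ 2 * a ^ 2 + q ^ 2 * b ^ 2 ≤ p ^ 2 * a ^ 2 + q ^ 2 * b ^ 2 + 2 * (p * a * (q * b)) :=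
        le_self_add
    _ = (p * a + q * b) ^ 2 := by ring

variable {n : ℕ} {S T : Set (Eucl n)} {ν : Eucl n → Eucl n} {K r : ℝ} {g₁ g₂ : Eucl n → ℝ}

/-- The squared trace inequality on the graph of a height function `s` of small slope; the graph
has at most `2 ^ (n - 1)` times the area element of `S`. -/
theorem HasTube.sq_eLpNorm_graph_le (hT : HasTube S ν K r) (hS : IsCompact S)
    (hg₁ : ContinuousOn g₁ S) (hg₂ : ContinuousOn g₂ S) {α β : ℝ} (hα : 0 < α)
    (h₁ : ∀ x ∈ S, α ≤ g₁ x ∧ g₁ x ≤ β) (h₂ : ∀ x ∈ S, α ≤ g₂ x ∧ g₂ x ≤ β) (hβ : β < r)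
    {C : NNReal} (hC : ∀ f : Eucl n → ENNReal, Measurable f →
      ∫⁻ x in S, (∫⁻ t in Set.Ioo (-r) r, f (x + t • ν x)) ∂μHE[n - 1] ≤ C * ∫⁻ z, f z)
    {v : Eucl n → ℝ} (hv : ContDiff ℝ ∞ v) {s : Eucl n → ℝ}
    (hs : ∀ x ∈ S, s x ∈ Set.Icc (-g₁ x) (g₂ x))
    (hlip : ∀ x ∈ S, ∀ᶠ p : Eucl n × Eucl n in 𝓝 (x, x), p.1 ∈ S → p.2 ∈ S →
      |s p.1 - s p.2| ≤ 3 / 4 * ‖p.1 - p.2‖) :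
    ∫⁻ y in (fun x => x + s x • ν x) '' S, ‖v y‖ₑ ^ 2 ∂μHE[n - 1] ≤ 2 ^ (n - 1) *
      (C * (ENNReal.ofReal (1 / α) * eLpNorm v 2 (volume.restrict (thinShell S ν g₁ g₂)) ^ 2
        + ENNReal.ofReal (2 * β)
          * eLpNorm (∇ v) 2 (volume.restrict (thinShell S ν g₁ g₂)) ^ 2)) := by
  have hsr : ∀ y ∈ S, |s y| ≤ r := fun y hy => abs_le.2
    ⟨by linarith [(hs y hy).1, (h₁ y hy).2], by linarith [(hs y hy).2, (h₂ y hy).2]⟩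
  have h2 : ∀ x ∈ S, ∀ᶠ p : Eucl n × Eucl n in 𝓝 (x, x), p.1 ∈ S → p.2 ∈ S →
      ‖(p.1 + s p.1 • ν p.1) - (p.2 + s p.2 • ν p.2)‖ ≤ (2 : NNReal) * ‖p.1 - p.2‖ := fun x hx =>
    hT.eventually_norm_sub_le hsr (hlip x hx)
  refine (setLIntegral_image_le hS (Φ := fun x => x + s x • ν x) h2 (n - 1)
    ((hv.continuous.measurable.enorm).pow_const 2)).trans ?_
  rw [ENNReal.coe_ofNat]
  gcongr
  exact hT.setLIntegral_graph_le hS hg₁ hg₂ hα h₁ h₂ hβ hC hv hs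

/-- The trace inequality for smooth functions on a set `T` covered by two graphs over `S`. -/
theorem HasTube.eLpNorm_le_of_subset (hT : HasTube S ν K r) (hS : IsCompact S)
    (hg₁ : ContinuousOn g₁ S) (hg₂ : ContinuousOn g₂ S) {C₁ C₂ h : ℝ} (hC₁ : 0 < C₁)
    (hh : 0 < h) (h₁ : ∀ x ∈ S, C₁ * h ≤ g₁ x ∧ g₁ x ≤ C₂ * h)
    (h₂ : ∀ x ∈ S, C₁ * h ≤ g₂ x ∧ g₂ x ≤ C₂ * h) (hβ : C₂ * h < r)
    {C : NNReal} (hC : ∀ f : Eucl n → ENNReal, Measurable f →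
      ∫⁻ x in S, (∫⁻ t in Set.Ioo (-r) r, f (x + t • ν x)) ∂μHE[n - 1] ≤ C * ∫⁻ z, f z)
    {D : ℝ} (hD : 0 < D) (hD1 : 2 * 2 ^ (n - 1) * C * (1 / C₁) ≤ D ^ 2)
    (hD2 : 2 * 2 ^ (n - 1) * C * (2 * C₂) ≤ D ^ 2)
    {s₁ s₂ : Eucl n → ℝ} (hs₁ : ∀ x ∈ S, s₁ x ∈ Set.Icc (-g₁ x) (g₂ x))
    (hs₂ : ∀ x ∈ S, s₂ x ∈ Set.Icc (-g₁ x) (g₂ x))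
    (hlip₁ : ∀ x ∈ S, ∀ᶠ p : Eucl n × Eucl n in 𝓝 (x, x), p.1 ∈ S → p.2 ∈ S →
      |s₁ p.1 - s₁ p.2| ≤ 3 / 4 * ‖p.1 - p.2‖)
    (hlip₂ : ∀ x ∈ S, ∀ᶠ p : Eucl n × Eucl n in 𝓝 (x, x), p.1 ∈ S → p.2 ∈ S →
      |s₂ p.1 - s₂ p.2| ≤ 3 / 4 * ‖p.1 - p.2‖)
    (hTs : T ⊆ (fun x => x + s₁ x • ν x) '' S ∪ (fun x => x + s₂ x • ν x) '' S)
    {v : Eucl n → ℝ} (hv : ContDiff ℝ ∞ v) :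
    eLpNorm v 2 (surfaceMeasure T) ≤
      ENNReal.ofReal (D * h ^ (-(1 / 2) : ℝ)) *
          eLpNorm v 2 (volume.restrict (thinShell S ν g₁ g₂)) +
        ENNReal.ofReal (D * h ^ (1 / 2 : ℝ)) *
          eLpNorm (∇ v) 2 (volume.restrict (thinShell S ν g₁ g₂)) := by
  have hα : 0 < C₁ * h := by positivity
  have b1 := hT.sq_eLpNorm_graph_le hS hg₁ hg₂ hα h₁ h₂ hβ hC hv hs₁ hlip₁
  have b2 := hT.sq_eLpNorm_graph_le hS hg₁ hg₂ hα h₁ h₂ hβ hC hv hs₂ hlip₂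
  set a := eLpNorm v 2 (volume.restrict (thinShell S ν g₁ g₂))
  set b := eLpNorm (∇ v) 2 (volume.restrict (thinShell S ν g₁ g₂))
  have e1 : (2 : ENNReal) * 2 ^ (n - 1) * C * ENNReal.ofReal (1 / (C₁ * h))
      ≤ ENNReal.ofReal (D * h ^ (-(1 / 2) : ℝ)) ^ 2 := by
    rw [← ENNReal.ofReal_pow (by positivity), ← ENNReal.ofReal_coe_nnreal,
      ← ENNReal.ofReal_ofNat 2, ← ENNReal.ofReal_pow (by norm_num),
      ← ENNReal.ofReal_mul (by norm_num), ← ENNReal.ofReal_mul (by positivity),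
      ← ENNReal.ofReal_mul (by positivity)]
    apply ENNReal.ofReal_le_ofReal
    have : (h ^ (-(1 / 2) : ℝ)) ^ 2 = h⁻¹ := by
      rw [← Real.rpow_natCast, ← Real.rpow_mul hh.le]; norm_num
      exact Real.rpow_neg_one h
    rw [mul_pow, this]
    calc _ = (2 * 2 ^ (n - 1) * C * (1 / C₁)) * h⁻¹ := by field_simp
      _ ≤ _ := by gcongr
  have e2 : (2 : ENNReal) * 2 ^ (n - 1) * C * ENNReal.ofReal (2 * (C₂ * h))
      ≤ ENNReal.ofReal (D * h ^ (1 / 2 : ℝ)) ^ 2 := by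
    rw [← ENNReal.ofReal_pow (by positivity), ← ENNReal.ofReal_coe_nnreal,
      ← ENNReal.ofReal_ofNat 2, ← ENNReal.ofReal_pow (by norm_num),
      ← ENNReal.ofReal_mul (by norm_num), ← ENNReal.ofReal_mul (by positivity),
      ← ENNReal.ofReal_mul (by positivity)]
    apply ENNReal.ofReal_le_ofReal
    have : (h ^ (1 / 2 : ℝ)) ^ 2 = h := by
      rw [← Real.rpow_natCast, ← Real.rpow_mul hh.le]; norm_num
    rw [mul_pow, this]
    calc _ = (2 * 2 ^ (n - 1) * C * (2 * C₂)) * h := by ring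
      _ ≤ _ := by gcongr
  refine ENNReal.le_mul_add_mul_of_sq_le ?_
  rw [eLpNorm_two_sq, surfaceMeasure]
  calc ∫⁻ y in T, ‖v y‖ₑ ^ 2 ∂μHE[n - 1]
      ≤ ∫⁻ y in (fun x => x + s₁ x • ν x) '' S ∪ (fun x => x + s₂ x • ν x) '' S,
          ‖v y‖ₑ ^ 2 ∂μHE[n - 1] := lintegral_mono_set hTs
    _ ≤ ∫⁻ y in (fun x => x + s₁ x • ν x) '' S, ‖v y‖ₑ ^ 2 ∂μHE[n - 1]
        + ∫⁻ y in (fun x => x + s₂ x • ν x) '' S, ‖v y‖ₑ ^ 2 ∂μHE[n - 1] :=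
      lintegral_union_le _ _ _
    _ ≤ _ := add_le_add b1 b2
    _ = (2 * 2 ^ (n - 1) * C * ENNReal.ofReal (1 / (C₁ * h))) * a ^ 2
        + (2 * 2 ^ (n - 1) * C * ENNReal.ofReal (2 * (C₂ * h))) * b ^ 2 := by ring
    _ ≤ _ := by gcongr

end Assembly

theorem mainTheorem9 (n : ℕ) (S : Set (Eucl n)) (ν : Eucl n → Eucl n)
    (hS_compact : IsCompact S) (hS : IsSmoothHypersurface S) (hν : IsUnitNormalField S ν)
    (C₁ C₂ C₃ : ℝ) (hC₁ : 0 < C₁) (hC₂ : 0 < C₂) (hC₃ : 0 < C₃) :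
    ∃ C : ℝ, 0 < C ∧ ∃ h₁ : ℝ, 0 < h₁ ∧
      ∀ (h₀ : ℝ) (g₁ g₂ : ℝ → Eucl n → ℝ), HypothesisH1 S ν C₁ C₂ C₃ h₀ g₁ g₂ →
      ∀ h : ℝ, 0 < h → h < h₀ → h < h₁ →
      ∀ (u : Eucl n → ℝ) (G : Eucl n → Eucl n),
        IsSobolevW12 (thinShell S ν (g₁ h) (g₂ h)) u G →
        ((∃ w, IsSobolevTrace (thinShell S ν (g₁ h) (g₂ h)) S u G w) ∧
          ∀ w, IsSobolevTrace (thinShell S ν (g₁ h) (g₂ h)) S u G w →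
            eLpNorm w 2 (surfaceMeasure S) ≤
              ENNReal.ofReal (C * h ^ (-(1 / 2) : ℝ)) *
                  eLpNorm u 2 (volume.restrict (thinShell S ν (g₁ h) (g₂ h))) +
                ENNReal.ofReal (C * h ^ (1 / 2 : ℝ)) *
                  eLpNorm G 2 (volume.restrict (thinShell S ν (g₁ h) (g₂ h)))) ∧
        ((∃ w, IsSobolevTrace (thinShell S ν (g₁ h) (g₂ h))
            (frontier (thinShell S ν (g₁ h) (g₂ h))) u G w) ∧
          ∀ w, IsSobolevTrace (thinShell S ν (g₁ h) (g₂ h))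
              (frontier (thinShell S ν (g₁ h) (g₂ h))) u G w →
            eLpNorm w 2 (surfaceMeasure (frontier (thinShell S ν (g₁ h) (g₂ h)))) ≤
              ENNReal.ofReal (C * h ^ (-(1 / 2) : ℝ)) *
                  eLpNorm u 2 (volume.restrict (thinShell S ν (g₁ h) (g₂ h))) +
                ENNReal.ofReal (C * h ^ (1 / 2 : ℝ)) *
                  eLpNorm G 2 (volume.restrict (thinShell S ν (g₁ h) (g₂ h)))) := by
  obtain ⟨K, r, hT⟩ := hν.exists_hasTube hS_compact
  obtain ⟨C, hC⟩ := hT.exists_tube_bound hS_compact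
  have hr := hT.r_pos
  set A : ℝ := 2 * 2 ^ (n - 1) * C with hA
  have hA0 : 0 ≤ A := by positivity
  -- a constant whose square dominates both coefficients of the squared inequality
  set D : ℝ := A * (1 / C₁) + A * (2 * C₂) + 1 with hD
  have hA1 : 0 ≤ A * (1 / C₁) := by positivity
  have hA2 : 0 ≤ A * (2 * C₂) := by positivity
  -- `h < r / C₂` keeps the shell inside the tube, and `h < 3 / (8 C₃)` makes the graphs have slope
  -- at most `3 / 4`
  refine ⟨D, by positivity, min (r / C₂) (3 / (8 * C₃)), by positivity,
    fun h₀ g₁ g₂ hH h hh hh₀ hh₁ u G hu => ?_⟩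
  obtain ⟨⟨hg₁, hb₁⟩, hg₂, hb₂⟩ := hH h hh hh₀
  have hβ : C₂ * h < r := by
    have := hh₁.trans_le (min_le_left _ _)
    rw [lt_div_iff₀ hC₂] at this
    linarith
  have hslope : 2 * (C₃ * h) ≤ 3 / 4 := by
    have := (hh₁.trans_le (min_le_right _ _)).le
    rw [le_div_iff₀ (by positivity)] at this
    linarith
  have hα : 0 < C₁ * h := by positivity
  have hl : ∀ {g : Eucl n → ℝ}, IsSmoothOnSurface S g → ThicknessBounds S ν C₁ C₂ C₃ h g →
      ∀ x ∈ S, ∀ᶠ p : Eucl n × Eucl n in 𝓝 (x, x), p.1 ∈ S → p.2 ∈ S →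
      |g p.1 - g p.2| ≤ 3 / 4 * ‖p.1 - p.2‖ := fun hg hb x hx => by
    filter_upwards [hν.eventually_abs_sub_le hx hg (B := C₃ * h) (by positivity) (hb x hx).2.2]
      with p hp hp1 hp2
    exact (hp hp1 hp2).trans (by gcongr)
  have hpos₁ : ∀ x ∈ S, 0 < g₁ h x ∧ g₁ h x < r := fun x hx =>
    ⟨hα.trans_le (hb₁ x hx).1, (hb₁ x hx).2.1.trans_lt hβ⟩
  have hpos₂ : ∀ x ∈ S, 0 < g₂ h x ∧ g₂ h x < r := fun x hx =>
    ⟨hα.trans_le (hb₂ x hx).1, (hb₂ x hx).2.1.trans_lt hβ⟩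
  have hΩb := isBounded_thinShell hS_compact hT (fun x hx => (hpos₁ x hx).2)
    fun x hx => (hpos₂ x hx).2
  have happrox := hu.exists_contDiff_approx (hT.isOpen_thinShell hg₁.continuousOn hg₂.continuousOn
    (fun x hx => (hpos₁ x hx).2) fun x hx => (hpos₂ x hx).2) hΩb
    fun z hz => hT.hasInteriorConeAt hS_compact hg₁ hg₂ hpos₁ hpos₂ hz
  have main : ∀ (T : Set (Eucl n)) (s₁ s₂ : Eucl n → ℝ),
      (∀ x ∈ S, s₁ x ∈ Set.Icc (-g₁ h x) (g₂ h x)) → (∀ x ∈ S, s₂ x ∈ Set.Icc (-g₁ h x) (g₂ h x)) →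
      (∀ x ∈ S, ∀ᶠ p : Eucl n × Eucl n in 𝓝 (x, x), p.1 ∈ S → p.2 ∈ S →
        |s₁ p.1 - s₁ p.2| ≤ 3 / 4 * ‖p.1 - p.2‖) →
      (∀ x ∈ S, ∀ᶠ p : Eucl n × Eucl n in 𝓝 (x, x), p.1 ∈ S → p.2 ∈ S →
        |s₂ p.1 - s₂ p.2| ≤ 3 / 4 * ‖p.1 - p.2‖) →
      T ⊆ (fun x => x + s₁ x • ν x) '' S ∪ (fun x => x + s₂ x • ν x) '' S →
      (∃ w, IsSobolevTrace (thinShell S ν (g₁ h) (g₂ h)) T u G w) ∧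
        ∀ w, IsSobolevTrace (thinShell S ν (g₁ h) (g₂ h)) T u G w →
          eLpNorm w 2 (surfaceMeasure T) ≤
            ENNReal.ofReal (D * h ^ (-(1 / 2) : ℝ)) *
                eLpNorm u 2 (volume.restrict (thinShell S ν (g₁ h) (g₂ h))) +
              ENNReal.ofReal (D * h ^ (1 / 2 : ℝ)) *
                eLpNorm G 2 (volume.restrict (thinShell S ν (g₁ h) (g₂ h))) := by
    intro T s₁ s₂ hs₁ hs₂ hl₁ hl₂ hTs
    have hineq := fun (v : Eucl n → ℝ) (hv : ContDiff ℝ ∞ v) =>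
      hT.eLpNorm_le_of_subset hS_compact hg₁.continuousOn hg₂.continuousOn hC₁ hh
        (fun x hx => ⟨(hb₁ x hx).1, (hb₁ x hx).2.1⟩) (fun x hx => ⟨(hb₂ x hx).1, (hb₂ x hx).2.1⟩)
        hβ hC (D := D) (by positivity) (by nlinarith) (by nlinarith) hs₁ hs₂ hl₁ hl₂ hTs hv
    exact ⟨hu.exists_isSobolevTrace hΩb ENNReal.ofReal_ne_top ENNReal.ofReal_ne_top hineq happrox,
      fun w hw => hw.eLpNorm_le hu ENNReal.ofReal_ne_top ENNReal.ofReal_ne_top hineq⟩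
  -- the surface itself is the graph of height `0`
  refine ⟨main S 0 0 ?_ ?_ ?_ ?_ ?_, main _ (fun x => -g₁ h x) (g₂ h) ?_ ?_ ?_ (hl hg₂ hb₂)
    (hT.frontier_thinShell_subset hS_compact hg₁.continuousOn hg₂.continuousOn hpos₁ hpos₂)⟩
  · exact fun x hx => ⟨by simpa using (hpos₁ x hx).1.le, (hpos₂ x hx).1.le⟩
  · exact fun x hx => ⟨by simpa using (hpos₁ x hx).1.le, (hpos₂ x hx).1.le⟩
  · exact fun x hx => Eventually.of_forall fun p _ _ => by simp
  · exact fun x hx => Eventually.of_forall fun p _ _ => by simp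
  · simp
  · exact fun x hx => ⟨le_rfl, by linarith [(hpos₁ x hx).1, (hpos₂ x hx).1]⟩
  · exact fun x hx => ⟨by linarith [(hpos₁ x hx).1, (hpos₂ x hx).1], le_rfl⟩
  · intro x hx
    filter_upwards [hl hg₁ hb₁ x hx] with p hp hp1 hp2
    rw [neg_sub_neg, abs_sub_comm]
    exact hp hp1 hp2
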